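/- Let $0\le m<N$, let $\Gamma=\hat\Gamma\times\hat\Gamma^\perp$ with $\hat\Gamma\subseteq\mathbb R^m$ and $\hat\Gamma^\perp\subseteq\mathbb R^{N-m}$ Borel, and write $\hat x=(x_1,\dots,x_m)$ for the resolved variables of $x\in\mathbb R^N$. Let $b:\Gamma\to\mathbb R^N$ be globally Lipschitz, $\hat b=(b_1,\dots,b_m)$, and let $\mu_0$ be a probability measure that is absolutely continuous with respect to Lebesgue measure and has finite second moment. Let $(X_t)_{t\ge0}$ be a $\Gamma$-valued random curve with $$\frac{d}{dt}X_t=b(X_t)\quad(t\ge 0),\qquad X_0\sim\mu_0 ,$$ let $\mu_t$ be the law of $X_t$ and let $\hat\mu_t$ be the law of $\hat X_t$, i.e. the image of $\mu_t$ under $x\mapsto\hat x$. Let $\mu_{t|y}$, $t\ge0$, $y\in\hat\Gamma$, be a (measurable) family of conditional probability measures on $\Gamma$ of $X\sim\mu_t$ given $\hat X=y$, and write $\mathbb E_{\mu_t}[f(X)\mid\hat X=y]=\int f\,d\mu_{t|y}$. Assume that there is a function $t\mapsto K_t\ge0$, integrable on every bounded interval $[0,T]$, such that $$\mathcal W_1(\mu_{t|y},\mu_{t|z})\le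 K_t\,|y-z|\qquad\text{for all } t\ge0,\ y,z\in\hat\Gamma,$$ where $\mathcal W_1$ is the 1-Wasserstein distance. Then: (a) Let $(Y_t)_{t\ge0}$ be any $\hat\Gamma$-valued random curve (a surrogate trajectory), on any probability space, with $Y_0\sim\hat\mu_0$ and $$dY_t=\mathbb E_{\mu_t}[\hat b(X)\mid\hat X=Y_t]\,dt,$$ that is, almost surely $Y_t=Y_0+\int_0^t\mathbb E_{\mu_s}[\hat b(X)\mid\hat X=Y_s]\,ds$ for all $t\ge0$, with integrable integrand. Then $Y_t\sim\hat\mu_t$ for every $t\ge0$. (b) For every $t\ge0$, $b\in L^2(\mu_t)$, and $\mathbb E_{\mu_t}[b(X)\mid\hat X=\cdot\,]$ is the optimal projection of $b$ in $L^2(\mu_t)$: it lies in $L^2(\hat\mu_t)$, the error $b(x)-\mathbb E_{\mu_t}[b(X)\mid\hat X=\hat x]$ is orthogonal in $L^2(\mu_t)$ to all $g(\hat x)$ with $g\in L^2(\hat\mu_t;\mathbb R^N)$, and it is the minimizer, unique up to $\hat\mu_t$-null sets, of $\int|b(x)-g(\hat x)|^2\,d\mu_t(x)$ over such $g$. The projected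 drift $\mathbb E_{\mu_t}[\hat b(X)\mid\hat X=y]$ consists of the first $m$ components of $\mathbb E_{\mu_t}[b(X)\mid\hat X=y]$ for every $y\in\hat\Gamma$, and is in the same sense the optimal projection of $\hat b$ among functions in $L^2(\hat\mu_t;\mathbb R^m)$. -/

import Mathlib

open MeasureTheory ProbabilityTheory Set
open scoped ENNReal NNReal

noncomputable section

namespace Surrogate

/-- `ℝⁿ` with its Euclidean norm. -/
abbrev E (n : ℕ) : Type := EuclideanSpace ℝ (Fin n)

/-- The resolved variables `(x₁, …, x_m)` of a state `x ∈ ℝᴺ`. -/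
def resolved {m N : ℕ} (h : m < N) (x : E N) : E m :=
  WithLp.toLp 2 fun i => x (Fin.castLE h.le i)

/-- The unresolved variables `(x_{m+1}, …, x_N)` of a state `x ∈ ℝᴺ`. -/
def unresolved {m N : ℕ} (h : m < N) (x : E N) : E (N - m) :=
  WithLp.toLp 2 fun j => x ⟨m + j, by have := j.isLt; omega⟩

/-- The phase space `Γ = Γr × Γu`, as a subset of `ℝᴺ`. -/
def phaseSpace {m N : ℕ} (h : m < N) (Γr : Set (E m)) (Γu : Set (E (N - m))) : Set (E N) :=
  {x | resolved h x ∈ Γr ∧ unresolved h x ∈ Γu}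

/-- The 1-Wasserstein distance: the least transport cost `∫ |x - y| dπ` over all couplings
`π` of `μ` and `ν`. -/
def wasserstein1 {n : ℕ} (μ ν : Measure (E n)) : ℝ≥0∞ :=
  ⨅ (π : Measure (E n × E n)) (_ : π.map Prod.fst = μ) (_ : π.map Prod.snd = ν),
    ∫⁻ p, edist p.1 p.2 ∂π

/-- The random curve `X` moves in `Γ` by the full dynamics `dX/dt = b(X)`, `t ≥ 0`, and starts
from the law `μ₀`. -/
structure IsFullSolution {Ω : Type*} [MeasurableSpace Ω] (P : Measure Ω) {N : ℕ}
    (Γ : Set (E N)) (b : E N → E N) (μ₀ : Measure (E N)) (X : ℝ → Ω → E N) : Prop where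
  measurable : ∀ t, 0 ≤ t → Measurable (X t)
  initial : P.map (X 0) = μ₀
  mem : ∀ᵐ ω ∂P, ∀ t, 0 ≤ t → X t ω ∈ Γ
  ode : ∀ᵐ ω ∂P, ∀ t, 0 ≤ t → HasDerivWithinAt (fun s => X s ω) (b (X t ω)) (Ici 0) t

/-- `κ (t, y)`, `t ≥ 0`, is (a version of) the conditional measure of a `μ t`-distributed state
in `Γ` given that its resolved variables equal `y`. -/
structure IsCondFamily {m N : ℕ} (h : m < N) (Γr : Set (E m)) (Γ : Set (E N))
    (μ : ℝ → Measure (E N)) (κ : Kernel (ℝ × E m) (E N)) : Prop where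
  disintegrate : ∀ t, 0 ≤ t →
    ((μ t).map (resolved h)) ⊗ₘ (κ.sectR t) = (μ t).map fun x => (resolved h x, x)
  support : ∀ t, 0 ≤ t → ∀ y ∈ Γr, κ (t, y) Γᶜ = 0

/-- The projected field `y ↦ 𝔼_{μ_t}[f(X) | X̂ = y]`, computed from the conditional measures. -/
def projected {m N : ℕ} {V : Type*} [NormedAddCommGroup V] [NormedSpace ℝ V]
    (κ : Kernel (ℝ × E m) (E N)) (f : E N → V) (t : ℝ) (y : E m) : V :=
  ∫ x, f x ∂κ (t, y)

/-- The random curve `Y` moves in `Γr` by `dY/dt = F(t, Y)`, `t ≥ 0`, in the sense of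
absolutely continuous solutions (`F` need not be continuous in time), and starts from the
law `ν₀`. -/
structure IsSurrogateSolution {Ω : Type*} [MeasurableSpace Ω] (Q : Measure Ω) {m : ℕ}
    (Γr : Set (E m)) (F : ℝ → E m → E m) (ν₀ : Measure (E m)) (Y : ℝ → Ω → E m) : Prop where
  measurable : ∀ t, 0 ≤ t → Measurable (Y t)
  initial : Q.map (Y 0) = ν₀
  mem : ∀ᵐ ω ∂Q, ∀ t, 0 ≤ t → Y t ω ∈ Γr
  integrable : ∀ᵐ ω ∂Q, ∀ t, 0 ≤ t → IntervalIntegrable (fun s => F s (Y s ω)) volume 0 t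
  ode : ∀ᵐ ω ∂Q, ∀ t, 0 ≤ t → Y t ω = Y 0 ω + ∫ s in (0 : ℝ)..t, F s (Y s ω)

/-- `p ∘ A` is the orthogonal projection, hence the unique best approximation, of `f` in
`L²(μ; V)` onto the square-integrable functions of the resolved variables `A`. -/
structure IsOptimalProjection {m N : ℕ} {V : Type*} [NormedAddCommGroup V]
    [InnerProductSpace ℝ V] (μ : Measure (E N)) (A : E N → E m) (f : E N → V) (p : E m → V) :
    Prop where
  memLp : MemLp f 2 μ
  memLp_proj : MemLp p 2 (μ.map A)
  orthogonal : ∀ g : E m → V, MemLp g 2 (μ.map A) → ∫ x, inner ℝ (f x - p (A x)) (g (A x)) ∂μ = 0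
  optimal : ∀ g : E m → V, MemLp g 2 (μ.map A) →
    ∫ x, ‖f x - p (A x)‖ ^ 2 ∂μ ≤ ∫ x, ‖f x - g (A x)‖ ^ 2 ∂μ
  unique : ∀ g : E m → V, MemLp g 2 (μ.map A) →
    ∫ x, ‖f x - g (A x)‖ ^ 2 ∂μ ≤ ∫ x, ‖f x - p (A x)‖ ^ 2 ∂μ → g =ᵐ[μ.map A] p

end Surrogate

end

open Surrogate

open Filter Topology

namespace Surrogate

/-! Let `x_t` be the resolved part of `X_t`, `y_t` a surrogate and `F_t` the projected drift. The
velocity of `x_t` is the resolved part of `b (X_t)`; its conditional expectation given `x_t` is `F_t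
(x_t)`, while `y_t` has velocity `F_t (y_t)`. By the Wasserstein hypothesis `F_t` is Lipschitz on
`Γr`, with a locally integrable constant `ℓ_t`.

Let `w t` be the infimum of `∫ |x_t - y_t|²` over couplings of the two probability spaces. Under a
fixed coupling the derivative of `|x - y|²` is `2⟨x - y, v - F x⟩ + 2⟨x - y, F x - F y⟩`, with `v`
the velocity of `x`. The second term is at most `2 ℓ |x - y|²`. The first has no sign in general,
but at each time the coupling may be exchanged for one with the same joint law of `(x_s, y_s)`,
hence the same cost, in which the two spaces are conditionally independent given `(x_s, y_s)`. Then
the conditional mean of `v - F x` given `(x_s, y_s)` is its conditional mean given `x_s`, which is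
zero, and the first term integrates to zero. Hence `w' ≤ 2 ℓ w` almost everywhere; since `w 0 = 0`
and `w` is absolutely continuous, Grönwall gives `w = 0`, which forces equal laws.

Only couplings with a density with respect to `P ⊗ Q` are admitted. The exchange is then explicit:
the new density is `f (x_s, y_s)`, with `f` the Radon-Nikodym derivative of the joint law, so
arbitrary probability spaces are allowed (`exists_density_coupling`,
`integral_inner_eq_zero_of_density`). Equal laws still have cost zero, by coupling inside small
cells. The differential inequality is `transportCost_slope_le`, and the argument is assembled in
`map_eq_of_conditional_velocity`.

The optimal projection property is Fubini for the disintegration, which gives orthogonality,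
followed by Pythagoras. -/

/-! ### Grönwall inequalities with an integrable rate. -/

lemma absolutelyContinuous_of_dist_le {V W : Type*} [PseudoMetricSpace V] [PseudoMetricSpace W]
    {f : ℝ → V} {g : ℝ → W} {a b C : ℝ} (hg : AbsolutelyContinuousOnInterval g a b)
    (h : ∀ s ∈ uIcc a b, ∀ t ∈ uIcc a b, dist (f s) (f t) ≤ C * dist (g s) (g t)) :
    AbsolutelyContinuousOnInterval f a b := by
  rw [absolutelyContinuousOnInterval_iff] at hg ⊢
  intro ε hε
  obtain ⟨δ, hδ, H⟩ := hg (ε / (|C| + 1)) (by positivity)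
  refine ⟨δ, hδ, fun E hE hlt => ?_⟩
  have h1 := H E hE hlt
  calc ∑ i ∈ Finset.range E.1, dist (f (E.2 i).1) (f (E.2 i).2)
      ≤ ∑ i ∈ Finset.range E.1, (|C| + 1) * dist (g (E.2 i).1) (g (E.2 i).2) := by
        refine Finset.sum_le_sum fun i hi => ?_
        have hm := hE.1 i hi
        refine (h _ hm.1 _ hm.2).trans ?_
        gcongr
        linarith [le_abs_self C]
    _ = (|C| + 1) * ∑ i ∈ Finset.range E.1, dist (g (E.2 i).1) (g (E.2 i).2) := by
        rw [Finset.mul_sum]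
    _ < (|C| + 1) * (ε / (|C| + 1)) := by gcongr
    _ = ε := by field_simp

/-- Transfers absolute continuity from a nonnegative primitive `κ` to the integrating factor `exp
(-κ)`. -/
lemma abs_exp_neg_sub_exp_neg_le {a b : ℝ} (ha : 0 ≤ a) (hb : 0 ≤ b) :
    |Real.exp (-a) - Real.exp (-b)| ≤ |a - b| := by
  wlog hab : a ≤ b generalizing a b
  · rw [abs_sub_comm, abs_sub_comm a b]
    exact this hb ha (le_of_not_ge hab)
  have h1 : Real.exp (-b) ≤ Real.exp (-a) := Real.exp_le_exp.2 (by linarith)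
  have h2 : Real.exp (-b) = Real.exp (-a) * Real.exp (a - b) := by
    rw [← Real.exp_add]; ring_nf
  have h3 := Real.add_one_le_exp (a - b)
  have h4 : Real.exp (-a) ≤ 1 := Real.exp_le_one_iff.2 (by linarith)
  rw [abs_of_nonneg (by linarith), abs_of_nonpos (by linarith)]
  nlinarith [Real.exp_pos (-a)]

/-- Grönwall's inequality for absolutely continuous functions with an integrable rate. -/
lemma le_mul_exp_of_ae_deriv_le {g k : ℝ → ℝ} {T : ℝ} (hT : 0 ≤ T)
    (hg : AbsolutelyContinuousOnInterval g 0 T) (hk : IntervalIntegrable k volume 0 T)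
    (hk0 : ∀ t ∈ Icc 0 T, 0 ≤ k t)
    (hder : ∀ᵐ t, t ∈ Ioo 0 T → ∀ g', HasDerivAt g g' t → g' ≤ k t * g t) :
    g T ≤ g 0 * Real.exp (∫ t in (0 : ℝ)..T, k t) := by
  set κ : ℝ → ℝ := fun t => ∫ r in (0 : ℝ)..t, k r with hκ
  have hκ0 : ∀ t ∈ uIcc 0 T, 0 ≤ κ t := fun t ht => by
    rw [uIcc_of_le hT] at ht
    exact intervalIntegral.integral_nonneg ht.1 fun u hu => hk0 u ⟨hu.1, hu.2.trans ht.2⟩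
  have hκac : AbsolutelyContinuousOnInterval κ 0 T :=
    hk.absolutelyContinuousOnInterval_intervalIntegral (by simp)
  have hE : AbsolutelyContinuousOnInterval (fun t => Real.exp (-κ t)) 0 T :=
    absolutelyContinuous_of_dist_le (C := 1) hκac fun s hs t ht => by
      rw [one_mul, Real.dist_eq, Real.dist_eq]
      exact abs_exp_neg_sub_exp_neg_le (hκ0 s hs) (hκ0 t ht)
  -- The product with the integrating factor is absolutely continuous with nonpositive derivative
  -- almost everywhere, so its increment, the integral of that derivative, is nonpositive.
  have hprod := hg.fun_mul hE
  have hint := hprod.integral_deriv_eq_sub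
  have hle : ∫ t in (0 : ℝ)..T, deriv (fun t => g t * Real.exp (-κ t)) t ≤ 0 := by
    rw [intervalIntegral.integral_of_le hT]
    refine integral_nonpos_of_ae ?_
    rw [EventuallyLE, ae_restrict_iff' measurableSet_Ioc]
    have hTne : ∀ᵐ t : ℝ, t ≠ T := by simp [ae_iff, measure_singleton]
    filter_upwards [hder, hg.ae_differentiableAt, hk.ae_hasDerivAt_integral, hTne]
      with t h1 h2 h3 h4 ht
    have htI : t ∈ uIcc 0 T := by rw [uIcc_of_le hT]; exact Ioc_subset_Icc_self ht
    have hgd := (h2 htI).hasDerivAt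
    have hκd : HasDerivAt κ (k t) t := h3 htI 0 (by simp)
    have hd := hgd.fun_mul (hκd.fun_neg.exp)
    rw [hd.deriv]
    have := h1 ⟨ht.1, lt_of_le_of_ne ht.2 h4⟩ _ hgd
    simp only [Pi.zero_apply]
    nlinarith [Real.exp_pos (-κ t)]
  rw [hint] at hle
  have hκz : κ 0 = 0 := by simp [hκ]
  simp only [hκz, neg_zero, Real.exp_zero, mul_one] at hle
  have : g T = g T * Real.exp (-κ T) * Real.exp (κ T) := by
    rw [mul_assoc, ← Real.exp_add]; simp
  rw [this]
  gcongr
  linarith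

/-- The integral form of Grönwall's inequality with an integrable rate. -/
lemma le_mul_exp_of_le_add_integral {u k : ℝ → ℝ} {c T : ℝ} (hT : 0 ≤ T)
    (hu : ContinuousOn u (Icc 0 T)) (hk : IntervalIntegrable k volume 0 T)
    (hk0 : ∀ t ∈ Icc 0 T, 0 ≤ k t)
    (h : ∀ t ∈ Icc 0 T, u t ≤ c + ∫ r in (0 : ℝ)..t, k r * u r) :
    u T ≤ c * Real.exp (∫ t in (0 : ℝ)..T, k t) := by
  have hku : IntervalIntegrable (fun r => k r * u r) volume 0 T :=
    hk.mul_continuousOn (by rwa [uIcc_of_le hT])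
  have hac0 := hku.absolutelyContinuousOnInterval_intervalIntegral (c := 0) (by simp)
  have hac : AbsolutelyContinuousOnInterval
      (fun t => c + ∫ r in (0 : ℝ)..t, k r * u r) 0 T :=
    absolutelyContinuous_of_dist_le (C := 1) hac0 fun s _ t _ => by simp [Real.dist_eq]
  -- The differential form is applied to the right-hand side of `h`, since `u` itself is only
  -- continuous.
  have := le_mul_exp_of_ae_deriv_le hT hac hk hk0 (by
    filter_upwards [hku.ae_hasDerivAt_integral] with t ht htI g' hg'
    have htI' : t ∈ Icc 0 T := Ioo_subset_Icc_self htI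
    have hd := (ht (by rwa [uIcc_of_le hT]) 0 (by simp)).const_add c
    rw [hg'.unique hd]
    exact mul_le_mul_of_nonneg_left (h t htI') (hk0 t htI'))
  simp only [intervalIntegral.integral_same, add_zero] at this
  exact (h T ⟨hT, le_rfl⟩).trans this

/-! ### Absolutely continuous couplings and their re-randomization. -/

section Couplings

variable {Ω Ω' : Type*} [MeasurableSpace Ω] [MeasurableSpace Ω']

/-- The couplings of `P` and `Q` that are absolutely continuous with respect to `P ⊗ Q`. -/
def acCouplings (P : Measure Ω) (Q : Measure Ω') : Set (Measure (Ω × Ω')) :=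
  {ρ | ρ ≪ P.prod Q ∧ ρ.map Prod.fst = P ∧ ρ.map Prod.snd = Q}

lemma prod_mem_acCouplings (P : Measure Ω) (Q : Measure Ω') [IsProbabilityMeasure P]
    [IsProbabilityMeasure Q] : P.prod Q ∈ acCouplings P Q :=
  ⟨Measure.AbsolutelyContinuous.rfl, measurePreserving_fst.map_eq, measurePreserving_snd.map_eq⟩

lemma map_withDensity_comp {α β : Type*} [MeasurableSpace α] [MeasurableSpace β] (μ : Measure α)
    {T : α → β} (hT : Measurable T) {f : β → ℝ≥0∞} (hf : Measurable f) :
    (μ.withDensity (f ∘ T)).map T = (μ.map T).withDensity f := by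
  ext s hs
  rw [Measure.map_apply hT hs, withDensity_apply _ (hT hs), withDensity_apply _ hs,
    setLIntegral_map hs hf hT]
  rfl

variable {V : Type*} [MeasurableSpace V]

/-- The marginal conditions say that the partial integrals of `f` equal one almost everywhere for
the laws of `X` and `Y`; this pulls back along `X` and `Y`, and Fubini gives the marginals `P` and
`Q`. -/
lemma withDensity_mem_acCouplings {P : Measure Ω} {Q : Measure Ω'} [IsProbabilityMeasure P]
    [IsProbabilityMeasure Q] {X : Ω → V} {Y : Ω' → V} (hX : Measurable X) (hY : Measurable Y)
    {f : V × V → ℝ≥0∞} (hf : Measurable f)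
    (h1 : (((P.map X).prod (Q.map Y)).withDensity f).map Prod.fst = P.map X)
    (h2 : (((P.map X).prod (Q.map Y)).withDensity f).map Prod.snd = Q.map Y) :
    (P.prod Q).withDensity (fun p => f (X p.1, Y p.2)) ∈ acCouplings P Q := by
  have : IsProbabilityMeasure (P.map X) := Measure.isProbabilityMeasure_map hX.aemeasurable
  have : IsProbabilityMeasure (Q.map Y) := Measure.isProbabilityMeasure_map hY.aemeasurable
  have hfm : Measurable fun p : Ω × Ω' => f (X p.1, Y p.2) := by fun_prop
  refine ⟨withDensity_absolutelyContinuous _ _, ?_, ?_⟩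
  · have hφ : (fun a => ∫⁻ b, f (a, b) ∂(Q.map Y)) =ᵐ[P.map X] 1 := by
      refine ae_eq_of_forall_setLIntegral_eq_of_sigmaFinite
        hf.lintegral_prod_right' measurable_const fun s hs _ => ?_
      have := congrArg (fun μ => μ s) h1
      simp only [Measure.map_apply measurable_fst hs,
        withDensity_apply _ (measurable_fst hs)] at this
      rw [← Set.prod_univ, ← Measure.prod_restrict, lintegral_prod _ hf.aemeasurable,
        Measure.restrict_univ] at this
      simpa using this
    have hφ' := ae_of_ae_map hX.aemeasurable hφ
    ext s hs
    rw [Measure.map_apply measurable_fst hs, withDensity_apply _ (measurable_fst hs),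
      ← Set.prod_univ, ← Measure.prod_restrict, lintegral_prod _ hfm.aemeasurable,
      Measure.restrict_univ]
    calc ∫⁻ a in s, ∫⁻ b, f (X a, Y b) ∂Q ∂P = ∫⁻ a in s, 1 ∂P := by
          refine lintegral_congr_ae (ae_restrict_of_ae ?_)
          filter_upwards [hφ'] with a ha
          rw [← lintegral_map (f := fun b => f (X a, b)) (by fun_prop) hY]
          exact ha
      _ = P s := by simp
  · have hφ : (fun b => ∫⁻ a, f (a, b) ∂(P.map X)) =ᵐ[Q.map Y] 1 := by
      refine ae_eq_of_forall_setLIntegral_eq_of_sigmaFinite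
        hf.lintegral_prod_left' measurable_const fun s hs _ => ?_
      have := congrArg (fun μ => μ s) h2
      simp only [Measure.map_apply measurable_snd hs,
        withDensity_apply _ (measurable_snd hs)] at this
      rw [← Set.univ_prod, ← Measure.prod_restrict, lintegral_prod_symm _ hf.aemeasurable,
        Measure.restrict_univ] at this
      simpa using this
    have hφ' := ae_of_ae_map hY.aemeasurable hφ
    ext s hs
    rw [Measure.map_apply measurable_snd hs, withDensity_apply _ (measurable_snd hs),
      ← Set.univ_prod, ← Measure.prod_restrict, lintegral_prod_symm _ hfm.aemeasurable,
      Measure.restrict_univ]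
    calc ∫⁻ b in s, ∫⁻ a, f (X a, Y b) ∂P ∂Q = ∫⁻ b in s, 1 ∂Q := by
          refine lintegral_congr_ae (ae_restrict_of_ae ?_)
          filter_upwards [hφ'] with b hb
          rw [← lintegral_map (f := fun a => f (a, Y b)) (by fun_prop) hX]
          exact hb
      _ = Q s := by simp

/-- A coupling may be replaced by one in which `P` and `Q` are conditionally independent given
`(X, Y)`, without changing the joint law of `(X, Y)`. -/
lemma exists_density_coupling {P : Measure Ω} {Q : Measure Ω'} [IsProbabilityMeasure P]
    [IsProbabilityMeasure Q] {X : Ω → V} {Y : Ω' → V} (hX : Measurable X) (hY : Measurable Y)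
    {ρ : Measure (Ω × Ω')} (hρ : ρ ∈ acCouplings P Q) :
    ∃ f : V × V → ℝ≥0∞, Measurable f ∧
      (P.prod Q).withDensity (fun p => f (X p.1, Y p.2)) ∈ acCouplings P Q ∧
      ((P.prod Q).withDensity (fun p => f (X p.1, Y p.2))).map (Prod.map X Y)
        = ρ.map (Prod.map X Y) := by
  have : IsProbabilityMeasure (P.map X) := Measure.isProbabilityMeasure_map hX.aemeasurable
  have : IsProbabilityMeasure (Q.map Y) := Measure.isProbabilityMeasure_map hY.aemeasurable
  have hXY : Measurable (Prod.map X Y) := hX.prodMap hY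
  obtain ⟨hac, hfst, hsnd⟩ := hρ
  have : IsProbabilityMeasure ρ := by
    constructor
    rw [← preimage_univ (f := Prod.fst), ← Measure.map_apply measurable_fst .univ, hfst,
      measure_univ]
  have hprod : (P.prod Q).map (Prod.map X Y) = (P.map X).prod (Q.map Y) :=
    (Measure.map_prod_map P Q hX hY).symm
  have hac' : ρ.map (Prod.map X Y) ≪ (P.map X).prod (Q.map Y) := hprod ▸ hac.map hXY
  have hwd := Measure.withDensity_rnDeriv_eq _ _ hac'
  -- Absolute continuity of `ρ` makes the joint law of `(X, Y)` recoverable from its density. Using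
  -- that density on `Ω × Ω'` forgets all other dependence between the two spaces.
  refine ⟨(ρ.map (Prod.map X Y)).rnDeriv ((P.map X).prod (Q.map Y)),
    Measure.measurable_rnDeriv _ _, ?_, ?_⟩
  · refine withDensity_mem_acCouplings hX hY (Measure.measurable_rnDeriv _ _) ?_ ?_
    · rw [hwd, Measure.map_map measurable_fst hXY, ← hfst, Measure.map_map hX measurable_fst]
      rfl
    · rw [hwd, Measure.map_map measurable_snd hXY, ← hsnd, Measure.map_map hY measurable_snd]
      rfl
  · have key := map_withDensity_comp (P.prod Q) hXY (Measure.measurable_rnDeriv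
      (ρ.map (Prod.map X Y)) ((P.map X).prod (Q.map Y)))
    rw [hprod, hwd] at key
    exact key

/-- Two variables with the same law can be coupled so that they fall into the same cell of a
countable partition. -/
lemma exists_coupling_same_cell {P : Measure Ω} {Q : Measure Ω'} [IsProbabilityMeasure P]
    [IsProbabilityMeasure Q] {X : Ω → V} {Y : Ω' → V} (hX : Measurable X) (hY : Measurable Y)
    (hXY : P.map X = Q.map Y) {c : V → ℕ} (hc : Measurable c) :
    ∃ ρ ∈ acCouplings P Q, ∀ᵐ p ∂ρ, c (X p.1) = c (Y p.2) := by
  set μ := P.map X with hμ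
  have : IsProbabilityMeasure μ := Measure.isProbabilityMeasure_map hX.aemeasurable
  -- This density draws both variables independently from `μ` conditioned on a common cell. Null
  -- cells, where the weight is infinite, are discarded by `hpos`.
  let f : V × V → ℝ≥0∞ := fun q => if c q.1 = c q.2 then (μ (c ⁻¹' {c q.1}))⁻¹ else 0
  have hmes : MeasurableSet {q : V × V | c q.1 = c q.2} :=
    measurableSet_eq_fun (hc.comp measurable_fst) (hc.comp measurable_snd)
  have hf : Measurable f := by
    refine Measurable.ite hmes ?_ measurable_const
    exact (measurable_from_top (f := fun n : ℕ => (μ (c ⁻¹' {n}))⁻¹)).comp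
      (hc.comp measurable_fst)
  have hpos : ∀ᵐ a ∂μ, μ (c ⁻¹' {c a}) ≠ 0 := by
    have : ∀ n, ∀ᵐ a ∂μ, c a = n → μ (c ⁻¹' {n}) ≠ 0 := fun n => by
      by_cases h0 : μ (c ⁻¹' {n}) = 0
      · have : ∀ᵐ a ∂μ, a ∉ c ⁻¹' {n} := measure_eq_zero_iff_ae_notMem.1 h0
        filter_upwards [this] with a ha hn
        exact absurd hn ha
      · exact Eventually.of_forall fun a _ => h0
    filter_upwards [ae_all_iff.2 this] with a ha using ha _ rfl
  have hone : ∀ᵐ a ∂μ, ∫⁻ b, f (a, b) ∂μ = 1 := by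
    filter_upwards [hpos] with a ha
    have : (fun b => f (a, b)) = (c ⁻¹' {c a}).indicator fun _ => (μ (c ⁻¹' {c a}))⁻¹ := by
      funext b
      simp [f, indicator, eq_comm]
    rw [this, lintegral_indicator (hc (measurableSet_singleton _)), setLIntegral_const,
      ENNReal.inv_mul_cancel ha (measure_ne_top _ _)]
  have hsymm : ∀ a b, f (a, b) = f (b, a) := fun a b => by
    by_cases h : c a = c b
    · simp [f, h]
    · simp [f, h, Ne.symm h]
  refine ⟨(P.prod Q).withDensity fun p => f (X p.1, Y p.2),
    withDensity_mem_acCouplings hX hY hf ?_ ?_, ?_⟩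
  · rw [← hXY, ← hμ]
    ext s hs
    rw [Measure.map_apply measurable_fst hs, withDensity_apply _ (measurable_fst hs),
      ← Set.prod_univ, ← Measure.prod_restrict, lintegral_prod _ hf.aemeasurable,
      Measure.restrict_univ, lintegral_congr_ae (ae_restrict_of_ae hone)]
    simp
  · rw [← hXY, ← hμ]
    ext s hs
    rw [Measure.map_apply measurable_snd hs, withDensity_apply _ (measurable_snd hs),
      ← Set.univ_prod, ← Measure.prod_restrict, lintegral_prod_symm _ hf.aemeasurable,
      Measure.restrict_univ]
    simp_rw [fun a b => hsymm a b]
    rw [lintegral_congr_ae (ae_restrict_of_ae hone)]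
    simp
  · have hfm : Measurable fun p : Ω × Ω' => f (X p.1, Y p.2) := by fun_prop
    rw [ae_withDensity_iff hfm]
    refine Eventually.of_forall fun p hp => ?_
    by_contra h
    exact hp (if_neg h)

end Couplings

/-! ### The quadratic transport cost, and when it vanishes. -/

lemma exists_measurable_cells (V : Type*) [NormedAddCommGroup V] [MeasurableSpace V]
    [BorelSpace V] [SecondCountableTopology V] {δ : ℝ} (hδ : 0 < δ) :
    ∃ c : V → ℕ, Measurable c ∧ ∀ a b, c a = c b → ‖a - b‖ ≤ δ := by
  classical
  have hex : ∀ a : V, ∃ n, dist a (TopologicalSpace.denseSeq V n) < δ / 2 := fun a => by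
    obtain ⟨n, hn⟩ := (TopologicalSpace.denseRange_denseSeq V).exists_dist_lt a (half_pos hδ)
    exact ⟨n, hn⟩
  refine ⟨fun a => Nat.find (hex a), measurable_find hex fun n => ?_, fun a b hab => ?_⟩
  · exact measurableSet_lt (by fun_prop) measurable_const
  · have ha := Nat.find_spec (hex a)
    have hb := Nat.find_spec (hex b)
    simp only at hab
    rw [← hab] at hb
    rw [← dist_eq_norm]
    linarith [dist_triangle_right a b (TopologicalSpace.denseSeq V (Nat.find (hex a)))]

section TransportCost

variable {Ω Ω' : Type*} [MeasurableSpace Ω] [MeasurableSpace Ω']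
  {P : Measure Ω} {Q : Measure Ω'}

lemma integrable_comp_fst {W : Type*} [NormedAddCommGroup W] {ρ : Measure (Ω × Ω')}
    (hρ : ρ ∈ acCouplings P Q) {g : Ω → W} (hg : Integrable g P) :
    Integrable (fun p => g p.1) ρ := by
  rw [← hρ.2.1] at hg
  exact hg.comp_measurable measurable_fst

lemma integrable_comp_snd {W : Type*} [NormedAddCommGroup W] {ρ : Measure (Ω × Ω')}
    (hρ : ρ ∈ acCouplings P Q) {g : Ω' → W} (hg : Integrable g Q) :
    Integrable (fun p => g p.2) ρ := by
  rw [← hρ.2.2] at hg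
  exact hg.comp_measurable measurable_snd

lemma integral_comp_fst {W : Type*} [NormedAddCommGroup W] [NormedSpace ℝ W]
    {ρ : Measure (Ω × Ω')} (hρ : ρ ∈ acCouplings P Q) {g : Ω → W}
    (hg : AEStronglyMeasurable g P) : ∫ p, g p.1 ∂ρ = ∫ ω, g ω ∂P := by
  conv_rhs => rw [← hρ.2.1]
  rw [← hρ.2.1] at hg
  exact (integral_map measurable_fst.aemeasurable hg).symm

lemma integral_comp_snd {W : Type*} [NormedAddCommGroup W] [NormedSpace ℝ W]
    {ρ : Measure (Ω × Ω')} (hρ : ρ ∈ acCouplings P Q) {g : Ω' → W}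
    (hg : AEStronglyMeasurable g Q) : ∫ p, g p.2 ∂ρ = ∫ ω, g ω ∂Q := by
  conv_rhs => rw [← hρ.2.2]
  rw [← hρ.2.2] at hg
  exact (integral_map measurable_snd.aemeasurable hg).symm

lemma ae_comp_fst {ρ : Measure (Ω × Ω')} (hρ : ρ ∈ acCouplings P Q) {p : Ω → Prop}
    (h : ∀ᵐ ω ∂P, p ω) : ∀ᵐ q ∂ρ, p q.1 := by
  rw [← hρ.2.1] at h
  exact ae_of_ae_map measurable_fst.aemeasurable h

lemma ae_comp_snd {ρ : Measure (Ω × Ω')} (hρ : ρ ∈ acCouplings P Q) {p : Ω' → Prop}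
    (h : ∀ᵐ ω ∂Q, p ω) : ∀ᵐ q ∂ρ, p q.2 := by
  rw [← hρ.2.2] at h
  exact ae_of_ae_map measurable_snd.aemeasurable h

lemma isProbabilityMeasure_of_mem_acCouplings [IsProbabilityMeasure P] {ρ : Measure (Ω × Ω')}
    (hρ : ρ ∈ acCouplings P Q) : IsProbabilityMeasure ρ := by
  constructor
  rw [← preimage_univ (f := Prod.fst), ← Measure.map_apply measurable_fst .univ, hρ.2.1,
    measure_univ]

variable {V : Type*} [NormedAddCommGroup V]

lemma memLp_comp_fst_sub_comp_snd {ρ : Measure (Ω × Ω')} (hρ : ρ ∈ acCouplings P Q) {X : Ω → V}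
    {Y : Ω' → V} (hX : MemLp X 2 P) (hY : MemLp Y 2 Q) :
    MemLp (fun p : Ω × Ω' => X p.1 - Y p.2) 2 ρ := by
  rw [← hρ.2.1] at hX
  rw [← hρ.2.2] at hY
  exact (hX.comp_of_map measurable_fst.aemeasurable).sub
    (hY.comp_of_map measurable_snd.aemeasurable)

/-- The least quadratic cost of transporting `f` to `g` over absolutely continuous couplings. -/
noncomputable def transportCost (P : Measure Ω) (Q : Measure Ω') (f : Ω → V) (g : Ω' → V) : ℝ :=
  ⨅ ρ : acCouplings P Q, ∫ p, ‖f p.1 - g p.2‖ ^ 2 ∂(ρ : Measure (Ω × Ω'))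

lemma transportCost_bddBelow (f : Ω → V) (g : Ω' → V) :
    BddBelow (range fun ρ : acCouplings P Q =>
      ∫ p, ‖f p.1 - g p.2‖ ^ 2 ∂(ρ : Measure (Ω × Ω'))) :=
  ⟨0, by rintro _ ⟨ρ, rfl⟩; exact integral_nonneg fun _ => by positivity⟩

lemma transportCost_nonneg (f : Ω → V) (g : Ω' → V) : 0 ≤ transportCost P Q f g :=
  Real.iInf_nonneg fun _ => integral_nonneg fun _ => by positivity

lemma transportCost_le {ρ : Measure (Ω × Ω')} (hρ : ρ ∈ acCouplings P Q) (f : Ω → V)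
    (g : Ω' → V) : transportCost P Q f g ≤ ∫ p, ‖f p.1 - g p.2‖ ^ 2 ∂ρ :=
  ciInf_le (transportCost_bddBelow f g) ⟨ρ, hρ⟩

variable [IsProbabilityMeasure P] [IsProbabilityMeasure Q]

instance : Nonempty (acCouplings P Q) := ⟨⟨_, prod_mem_acCouplings P Q⟩⟩

lemma le_transportCost {f : Ω → V} {g : Ω' → V} {c : ℝ}
    (h : ∀ ρ ∈ acCouplings P Q, c ≤ ∫ p, ‖f p.1 - g p.2‖ ^ 2 ∂ρ) : c ≤ transportCost P Q f g :=
  le_ciInf fun ρ => h ρ.1 ρ.2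

lemma exists_lt_of_transportCost_lt {f : Ω → V} {g : Ω' → V} {c : ℝ}
    (h : transportCost P Q f g < c) :
    ∃ ρ ∈ acCouplings P Q, ∫ p, ‖f p.1 - g p.2‖ ^ 2 ∂ρ < c := by
  obtain ⟨ρ, hρ⟩ := exists_lt_of_ciInf_lt h
  exact ⟨ρ.1, ρ.2, hρ⟩

variable [MeasurableSpace V] [BorelSpace V] [SecondCountableTopology V]

/-- The coupling along `X = Y` is in general singular to `P ⊗ Q`, so cost zero is only approached,
by coupling within cells of diameter at most `√ε`. -/
lemma transportCost_eq_zero_of_map_eq {X : Ω → V} {Y : Ω' → V} (hX : Measurable X)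
    (hY : Measurable Y) (hXY : P.map X = Q.map Y) : transportCost P Q X Y = 0 := by
  refine le_antisymm (le_of_forall_pos_le_add fun ε hε => ?_) (transportCost_nonneg _ _)
  obtain ⟨c, hc, hcd⟩ := exists_measurable_cells V (Real.sqrt_pos.2 hε)
  obtain ⟨ρ, hρ, hae⟩ := exists_coupling_same_cell hX hY hXY hc
  have := isProbabilityMeasure_of_mem_acCouplings hρ
  refine (transportCost_le hρ _ _).trans ?_
  calc ∫ p, ‖X p.1 - Y p.2‖ ^ 2 ∂ρ ≤ ∫ _, ε ∂ρ := by
        refine integral_mono_of_nonneg (Eventually.of_forall fun _ => by positivity)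
          (integrable_const _) ?_
        filter_upwards [hae] with p hp
        rw [← Real.sq_sqrt hε.le]
        gcongr
        exact hcd _ _ hp
    _ = 0 + ε := by simp

/-- Characteristic functions suffice. The map `x ↦ exp (i⟨x, t⟩)` is `‖t‖`-Lipschitz, and the mean
distance under a coupling is controlled by its quadratic cost through `r ≤ τ + τ⁻¹ r²`. -/
lemma map_eq_of_transportCost_eq_zero [InnerProductSpace ℝ V] [CompleteSpace V] {X : Ω → V}
    {Y : Ω' → V}
    (hX : Measurable X) (hY : Measurable Y) (hX2 : MemLp X 2 P) (hY2 : MemLp Y 2 Q)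
    (h : transportCost P Q X Y = 0) : P.map X = Q.map Y := by
  have : IsProbabilityMeasure (P.map X) := Measure.isProbabilityMeasure_map hX.aemeasurable
  have : IsProbabilityMeasure (Q.map Y) := Measure.isProbabilityMeasure_map hY.aemeasurable
  refine Measure.ext_of_charFun (funext fun t => ?_)
  have hmt : Measurable fun x : V => Complex.exp (inner ℝ x t * Complex.I) := by fun_prop
  have hb : ∀ x : V, ‖Complex.exp (inner ℝ x t * Complex.I)‖ = 1 := fun x =>
    Complex.norm_exp_ofReal_mul_I _
  rw [charFun_apply, charFun_apply,
    integral_map hX.aemeasurable hmt.aestronglyMeasurable,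
    integral_map hY.aemeasurable hmt.aestronglyMeasurable]
  have hiX : Integrable (fun ω => Complex.exp (inner ℝ (X ω) t * Complex.I)) P :=
    Integrable.of_bound (hmt.comp hX).aestronglyMeasurable 1
      (Eventually.of_forall fun ω => (hb _).le)
  have hiY : Integrable (fun ω => Complex.exp (inner ℝ (Y ω) t * Complex.I)) Q :=
    Integrable.of_bound (hmt.comp hY).aestronglyMeasurable 1
      (Eventually.of_forall fun ω => (hb _).le)
  rw [← sub_eq_zero, ← norm_le_zero_iff]
  refine le_of_forall_pos_le_add fun ε hε => ?_
  -- With a coupling of cost below `τ²` the final bound is `2 ‖t‖ τ`, which this choice keeps below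
  -- `ε`.
  set τ := ε / (2 * (‖t‖ + 1)) with hτ
  have hτ0 : 0 < τ := by positivity
  obtain ⟨ρ, hρ, hlt⟩ := exists_lt_of_transportCost_lt (h ▸ (by positivity : 0 < τ ^ 2))
  have := isProbabilityMeasure_of_mem_acCouplings hρ
  rw [← integral_comp_fst hρ hiX.1, ← integral_comp_snd hρ hiY.1,
    ← integral_sub (integrable_comp_fst hρ hiX) (integrable_comp_snd hρ hiY)]
  have hint := (memLp_comp_fst_sub_comp_snd hρ hX2 hY2).integrable_norm_pow (by norm_num)
  have hpt : ∀ p : Ω × Ω', ‖Complex.exp (inner ℝ (X p.1) t * Complex.I)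
      - Complex.exp (inner ℝ (Y p.2) t * Complex.I)‖
      ≤ ‖t‖ * (τ + τ⁻¹ * ‖X p.1 - Y p.2‖ ^ 2) := fun p => by
    have h1 : ‖Complex.exp (inner ℝ (X p.1) t * Complex.I)
      - Complex.exp (inner ℝ (Y p.2) t * Complex.I)‖ ≤ |inner ℝ (X p.1) t - inner ℝ (Y p.2) t| := by
      have e : Complex.exp (inner ℝ (X p.1) t * Complex.I)
          - Complex.exp (inner ℝ (Y p.2) t * Complex.I)
          = Complex.exp (inner ℝ (Y p.2) t * Complex.I) *
            (Complex.exp (Complex.I * ((inner ℝ (X p.1) t - inner ℝ (Y p.2) t : ℝ) : ℂ)) - 1) := by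
        rw [mul_sub, ← Complex.exp_add]
        push_cast
        ring_nf
      rw [e, norm_mul, hb, one_mul]
      exact Real.norm_exp_I_mul_ofReal_sub_one_le
    rw [← inner_sub_left] at h1
    refine h1.trans ((abs_real_inner_le_norm _ _).trans ?_)
    rw [mul_comm]
    gcongr
    have : τ⁻¹ * ‖X p.1 - Y p.2‖ ^ 2 + τ - ‖X p.1 - Y p.2‖
        = τ⁻¹ * ((‖X p.1 - Y p.2‖ - τ / 2) ^ 2 + 3 / 4 * τ ^ 2) := by
      field_simp; ring
    have h2 : 0 ≤ τ⁻¹ * ((‖X p.1 - Y p.2‖ - τ / 2) ^ 2 + 3 / 4 * τ ^ 2) := by positivity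
    linarith
  calc _ ≤ ∫ p : Ω × Ω', ‖t‖ * (τ + τ⁻¹ * ‖X p.1 - Y p.2‖ ^ 2) ∂ρ := by
        refine norm_integral_le_of_norm_le ?_ (Eventually.of_forall hpt)
        exact ((integrable_const _).add (hint.const_mul _)).const_mul _
    _ = ‖t‖ * (τ + τ⁻¹ * ∫ p : Ω × Ω', ‖X p.1 - Y p.2‖ ^ 2 ∂ρ) := by
        rw [integral_const_mul, integral_add (integrable_const _) (hint.const_mul _),
          integral_const_mul]
        simp
    _ ≤ ‖t‖ * (τ + τ⁻¹ * τ ^ 2) := by gcongr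
    _ = ε * (‖t‖ / (‖t‖ + 1)) := by rw [hτ]; field_simp; ring
    _ ≤ ε * 1 := by
        gcongr
        rw [div_le_one (by positivity)]; linarith
    _ = 0 + ε := by ring

end TransportCost

/-! ### One infinitesimal time step of the transport cost. -/

/-- The displacement `Δ` over a time `h` has three parts: `u`, whose pairing with `D` will integrate
to zero and is therefore kept exact; `w`, the Lipschitz difference of drifts; and `η`, the error of
the difference quotients, absorbed by Young's inequality with weight `τ`. -/
lemma inner_expansion_le {W : Type*} [NormedAddCommGroup W] [InnerProductSpace ℝ W]
    {D Δ u w η : W} {h τ ℓ : ℝ} (hh : 0 < h)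
    (hτ : 0 < τ) (hΔ : Δ = h • (u + w + η)) (hw : ‖w‖ ≤ ℓ * ‖D‖) :
    ‖D + Δ‖ ^ 2 ≤ ‖D‖ ^ 2 + 2 * h * inner ℝ D u + 2 * h * ℓ * ‖D‖ ^ 2
      + h * (τ * ‖D‖ ^ 2 + τ⁻¹ * ‖η‖ ^ 2) + ‖Δ‖ ^ 2 := by
  rw [norm_add_sq_real, hΔ, inner_smul_right, inner_add_right, inner_add_right]
  have h1 : inner ℝ D w ≤ ℓ * ‖D‖ ^ 2 :=
    calc inner ℝ D w ≤ ‖D‖ * ‖w‖ := real_inner_le_norm _ _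
      _ ≤ ‖D‖ * (ℓ * ‖D‖) := by gcongr
      _ = ℓ * ‖D‖ ^ 2 := by ring
  have h2 : 2 * inner ℝ D η ≤ τ * ‖D‖ ^ 2 + τ⁻¹ * ‖η‖ ^ 2 := by
    have e1 := real_inner_le_norm D η
    have e2 : τ * ‖D‖ ^ 2 + τ⁻¹ * ‖η‖ ^ 2 - 2 * (‖D‖ * ‖η‖) = τ⁻¹ * (τ * ‖D‖ - ‖η‖) ^ 2 := by
      field_simp; ring
    have e3 : 0 ≤ τ⁻¹ * (τ * ‖D‖ - ‖η‖) ^ 2 := by positivity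
    linarith
  nlinarith

lemma _root_.MeasureTheory.MemLp.integrable_inner_of_memLp {α W : Type*} [MeasurableSpace α]
    [NormedAddCommGroup W] [InnerProductSpace ℝ W] {μ : Measure α} {f g : α → W}
    (hf : MemLp f 2 μ) (hg : MemLp g 2 μ) : Integrable (fun a => inner ℝ (f a) (g a)) μ :=
  (hf.norm.integrable_mul hg.norm).mono' (hf.1.inner hg.1)
    (Eventually.of_forall fun _ => norm_inner_le_norm _ _)

lemma _root_.MeasureTheory.MemLp.integrable_norm_sq' {α W : Type*} [MeasurableSpace α]
    [NormedAddCommGroup W] {μ : Measure α} {f : α → W} (hf : MemLp f 2 μ) :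
    Integrable (fun a => ‖f a‖ ^ 2) μ :=
  hf.integrable_norm_pow (by norm_num)

section Step

variable {Ω Ω' : Type*} [MeasurableSpace Ω] [MeasurableSpace Ω']
  {P : Measure Ω} {Q : Measure Ω'} {V : Type*} [NormedAddCommGroup V]

lemma integral_comp_fst_add_comp_snd {ρ : Measure (Ω × Ω')} (hρ : ρ ∈ acCouplings P Q)
    {f : Ω → ℝ} {g : Ω' → ℝ} (hf : Integrable f P) (hg : Integrable g Q) (a : ℝ) :
    ∫ p, (a * f p.1 + a * g p.2) ∂ρ = a * (∫ ω, f ω ∂P + ∫ ω, g ω ∂Q) := by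
  rw [integral_add ((integrable_comp_fst hρ hf).const_mul _)
    ((integrable_comp_snd hρ hg).const_mul _), integral_const_mul, integral_const_mul,
    integral_comp_fst hρ hf.1, integral_comp_snd hρ hg.1, mul_add]

/-- Pointwise and dominated differentiability implies differentiability in `L²`. -/
lemma tendsto_integral_sq_slope_sub [InnerProductSpace ℝ V] {Xn : ℕ → Ω → V} {X₀ v : Ω → V} {R : Ω → ℝ} {h : ℕ → ℝ}
    {c : ℝ} (hXn : ∀ᶠ n in atTop, AEStronglyMeasurable (Xn n) P)
    (hX₀ : AEStronglyMeasurable X₀ P) (hv : AEStronglyMeasurable v P)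
    (hR : MemLp R 2 P) (hh : ∀ᶠ n in atTop, 0 < h n)
    (hb : ∀ᶠ n in atTop, ∀ᵐ ω ∂P, ‖Xn n ω - X₀ ω‖ ≤ c * h n * R ω)
    (hlim : ∀ᵐ ω ∂P, Tendsto (fun n => (h n)⁻¹ • (Xn n ω - X₀ ω)) atTop (𝓝 (v ω))) :
    MemLp v 2 P ∧
    (∀ᶠ n in atTop, Integrable (fun ω => ‖(h n)⁻¹ • (Xn n ω - X₀ ω) - v ω‖ ^ 2) P) ∧
    Tendsto (fun n => ∫ ω, ‖(h n)⁻¹ • (Xn n ω - X₀ ω) - v ω‖ ^ 2 ∂P) atTop (𝓝 0) := by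
  have hb' : ∀ᶠ n in atTop, ∀ᵐ ω ∂P, ‖(h n)⁻¹ • (Xn n ω - X₀ ω)‖ ≤ c * R ω := by
    filter_upwards [hb, hh] with n hn hp
    filter_upwards [hn] with ω hω
    rw [norm_smul, norm_inv, Real.norm_eq_abs, abs_of_pos hp, inv_mul_le_iff₀ hp]
    linarith
  have hvb : ∀ᵐ ω ∂P, ‖v ω‖ ≤ c * R ω := by
    obtain ⟨n₀, hn₀⟩ := eventually_atTop.1 hb'
    have : ∀ᵐ ω ∂P, ∀ n, n₀ ≤ n → ‖(h n)⁻¹ • (Xn n ω - X₀ ω)‖ ≤ c * R ω := by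
      rw [ae_all_iff]
      intro n
      by_cases hn : n₀ ≤ n
      · filter_upwards [hn₀ n hn] with ω hω _ using hω
      · exact Eventually.of_forall fun ω h => absurd h hn
    filter_upwards [this, hlim] with ω h1 h2
    exact le_of_tendsto h2.norm (eventually_atTop.2 ⟨n₀, fun n hn => h1 n hn⟩)
  have hcR : MemLp (fun ω => 2 * (c * R ω)) 2 P := (hR.const_mul c).const_mul 2
  have hm : ∀ᶠ n in atTop,
      AEStronglyMeasurable (fun ω => (h n)⁻¹ • (Xn n ω - X₀ ω) - v ω) P := by
    filter_upwards [hXn] with n hn using ((hn.sub hX₀).const_smul _).sub hv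
  have hbd : ∀ᶠ n in atTop, ∀ᵐ ω ∂P,
      ‖(h n)⁻¹ • (Xn n ω - X₀ ω) - v ω‖ ≤ 2 * (c * R ω) := by
    filter_upwards [hb'] with n hn
    filter_upwards [hn, hvb] with ω h1 h2
    exact (norm_sub_le _ _).trans (by linarith)
  refine ⟨(hR.const_mul c).mono' hv hvb, ?_, ?_⟩
  · filter_upwards [hm, hbd] with n h1 h2
    exact (hcR.mono' h1 h2).integrable_norm_sq'
  · have := tendsto_integral_filter_of_dominated_convergence (l := atTop)
      (F := fun n ω => ‖(h n)⁻¹ • (Xn n ω - X₀ ω) - v ω‖ ^ 2) (f := fun _ => (0 : ℝ))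
      (μ := P) (fun ω => (2 * (c * R ω)) ^ 2) ?_ ?_ hcR.integrable_sq ?_
    · simpa using this
    · filter_upwards [hm] with n hn using hn.norm.pow 2
    · filter_upwards [hbd] with n hn
      filter_upwards [hn] with ω hω
      rw [norm_pow, norm_norm]
      gcongr
    · filter_upwards [hlim] with ω hω
      have := ((hω.sub_const (v ω)).norm).pow 2
      simpa using this

variable [IsProbabilityMeasure P] [IsProbabilityMeasure Q]

/-- The transport cost changes at most linearly when both variables are perturbed. -/
lemma transportCost_le_add {X₀ X₁ : Ω → V} {Y₀ Y₁ : Ω' → V} {R₁ : Ω → ℝ} {R₂ : Ω' → ℝ} {c : ℝ}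
    (hX₀ : MemLp X₀ 2 P) (hY₀ : MemLp Y₀ 2 Q)
    (hR₁ : MemLp R₁ 2 P) (hR₂ : MemLp R₂ 2 Q)
    (h1 : ∀ᵐ ω ∂P, ‖X₀ ω‖ ≤ R₁ ω ∧ ‖X₁ ω‖ ≤ R₁ ω ∧ ‖X₁ ω - X₀ ω‖ ≤ c * R₁ ω)
    (h2 : ∀ᵐ ω ∂Q, ‖Y₀ ω‖ ≤ R₂ ω ∧ ‖Y₁ ω‖ ≤ R₂ ω ∧ ‖Y₁ ω - Y₀ ω‖ ≤ c * R₂ ω) (hc : 0 ≤ c) :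
    transportCost P Q X₁ Y₁ ≤ transportCost P Q X₀ Y₀ +
      4 * c * (∫ ω, R₁ ω ^ 2 ∂P + ∫ ω, R₂ ω ^ 2 ∂Q) := by
  -- With the error on the left, the bound can be checked against each coupling separately: the
  -- error depends on the marginals only.
  rw [← sub_le_iff_le_add]
  refine le_transportCost fun ρ hρ => ?_
  rw [sub_le_iff_le_add]
  refine (transportCost_le hρ _ _).trans ?_
  have i0 := (memLp_comp_fst_sub_comp_snd hρ hX₀ hY₀).integrable_norm_sq'
  have i1 := hR₁.integrable_sq
  have i2 := hR₂.integrable_sq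
  have i3 : Integrable (fun p : Ω × Ω' => 4 * c * R₁ p.1 ^ 2 + 4 * c * R₂ p.2 ^ 2) ρ :=
    ((integrable_comp_fst hρ i1).const_mul _).add ((integrable_comp_snd hρ i2).const_mul _)
  rw [← integral_comp_fst_add_comp_snd hρ i1 i2, ← integral_add i0 i3]
  refine integral_mono_of_nonneg (Eventually.of_forall fun _ => by positivity) (i0.add i3) ?_
  filter_upwards [ae_comp_fst hρ h1, ae_comp_snd hρ h2] with p hp hq
  obtain ⟨a0, a1, a2⟩ := hp
  obtain ⟨b0, b1, b2⟩ := hq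
  have e1 : ‖X₁ p.1 - Y₁ p.2‖ ≤ ‖X₀ p.1 - Y₀ p.2‖ + c * (R₁ p.1 + R₂ p.2) := by
    have : X₁ p.1 - Y₁ p.2 = (X₀ p.1 - Y₀ p.2) + ((X₁ p.1 - X₀ p.1) - (Y₁ p.2 - Y₀ p.2)) := by
      abel
    rw [this]
    refine (norm_add_le _ _).trans ?_
    gcongr
    refine (norm_sub_le _ _).trans ?_
    linarith
  have e2 : ‖X₁ p.1 - Y₁ p.2‖ ≤ R₁ p.1 + R₂ p.2 := (norm_sub_le _ _).trans (by linarith)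
  have e3 : ‖X₀ p.1 - Y₀ p.2‖ ≤ R₁ p.1 + R₂ p.2 := (norm_sub_le _ _).trans (by linarith)
  have p1 := norm_nonneg (X₁ p.1 - Y₁ p.2)
  have p0 := norm_nonneg (X₀ p.1 - Y₀ p.2)
  have pR : 0 ≤ R₁ p.1 + R₂ p.2 := p0.trans e3
  set A := ‖X₁ p.1 - Y₁ p.2‖
  set B := ‖X₀ p.1 - Y₀ p.2‖
  set r := R₁ p.1
  set q := R₂ p.2
  -- The factor `4` of the statement arises from `2 c (r + q)² ≤ 4 c (r² + q²)`.
  have k1 : A ^ 2 - B ^ 2 ≤ c * (r + q) * (2 * (r + q)) := by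
    have : A ^ 2 - B ^ 2 = (A - B) * (A + B) := by ring
    rw [this]
    calc (A - B) * (A + B) ≤ c * (r + q) * (A + B) := by gcongr; linarith
      _ ≤ c * (r + q) * (2 * (r + q)) := by gcongr; linarith
  nlinarith [mul_nonneg hc (sq_nonneg (r - q))]

variable [InnerProductSpace ℝ V] [MeasurableSpace V] [BorelSpace V] [SecondCountableTopology V]

/-- In a coupling with density `f (X, Y)`, a variable with vanishing conditional expectation given
`X` is orthogonal to `X - Y`. -/
lemma integral_inner_eq_zero_of_density {X : Ω → V} {Y : Ω' → V} {Z : Ω → V}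
    {f : V × V → ℝ≥0∞} (hX : Measurable X) (hY : Measurable Y) (hf : Measurable f)
    (hρ : (P.prod Q).withDensity (fun p => f (X p.1, Y p.2)) ∈ acCouplings P Q)
    (hint : Integrable (fun p : Ω × Ω' => inner ℝ (X p.1 - Y p.2) (Z p.1))
      ((P.prod Q).withDensity (fun p => f (X p.1, Y p.2))))
    (hZ : ∀ ψ : V → V, Measurable ψ → Integrable (fun ω => inner ℝ (ψ (X ω)) (Z ω)) P →
      ∫ ω, inner ℝ (ψ (X ω)) (Z ω) ∂P = 0) :
    ∫ p : Ω × Ω', inner ℝ (X p.1 - Y p.2) (Z p.1)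
      ∂((P.prod Q).withDensity (fun p => f (X p.1, Y p.2))) = 0 := by
  have hfm : Measurable fun p : Ω × Ω' => f (X p.1, Y p.2) := by fun_prop
  have hprob := isProbabilityMeasure_of_mem_acCouplings hρ
  have hfin : ∀ᵐ p ∂(P.prod Q), f (X p.1, Y p.2) < ∞ := by
    refine ae_lt_top hfm ?_
    have := hprob.measure_univ
    rw [withDensity_apply _ .univ, Measure.restrict_univ] at this
    rw [this]
    exact ENNReal.one_ne_top
  rw [integrable_withDensity_iff_integrable_smul' hfm hfin] at hint
  rw [integral_withDensity_eq_integral_toReal_smul hfm hfin, integral_prod_symm _ hint]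
  refine integral_eq_zero_of_ae ?_
  filter_upwards [hint.prod_left_ae] with y hy
  -- Once the point of `Ω'` is frozen, density times `X - Y` is a function of `X` alone, so the
  -- hypothesis on `Z` applies to the inner integral.
  have hψ := hZ (fun a => (f (a, Y y)).toReal • (a - Y y)) (by fun_prop)
  simp only [inner_smul_left, smul_eq_mul, RCLike.conj_to_real] at hψ hy ⊢
  exact hψ hy

/-- One time step of the re-randomized coupling. -/
lemma transportCost_le_of_coupling {X₀ X₁ vx Fx : Ω → V} {Y₀ Y₁ vy : Ω' → V} {R₁ : Ω → ℝ}
    {R₂ : Ω' → ℝ} {c h ℓ τ : ℝ} (hX₀ : Measurable X₀) (hY₀ : Measurable Y₀)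
    (hX₀2 : MemLp X₀ 2 P) (hY₀2 : MemLp Y₀ 2 Q) (hvx : MemLp vx 2 P) (hFx : MemLp Fx 2 P)
    (hR₁ : MemLp R₁ 2 P) (hR₂ : MemLp R₂ 2 Q)
    (h1 : ∀ᵐ ω ∂P, ‖X₀ ω‖ ≤ R₁ ω ∧ ‖X₁ ω - X₀ ω‖ ≤ c * h * R₁ ω)
    (h2 : ∀ᵐ ω ∂Q, ‖Y₀ ω‖ ≤ R₂ ω ∧ ‖Y₁ ω - Y₀ ω‖ ≤ c * h * R₂ ω)
    (hlip : ∀ᵐ p ∂P.prod Q, ‖Fx p.1 - vy p.2‖ ≤ ℓ * ‖X₀ p.1 - Y₀ p.2‖)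
    (hcond : ∀ ψ : V → V, Measurable ψ →
      Integrable (fun ω => inner ℝ (ψ (X₀ ω)) (vx ω - Fx ω)) P →
      ∫ ω, inner ℝ (ψ (X₀ ω)) (vx ω - Fx ω) ∂P = 0)
    (hZx : Integrable (fun ω => ‖h⁻¹ • (X₁ ω - X₀ ω) - vx ω‖ ^ 2) P)
    (hZy : Integrable (fun ω => ‖h⁻¹ • (Y₁ ω - Y₀ ω) - vy ω‖ ^ 2) Q)
    (hh : 0 < h) (hτ : 0 < τ) {ρ : Measure (Ω × Ω')} (hρ : ρ ∈ acCouplings P Q) :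
    transportCost P Q X₁ Y₁ ≤ (1 + 2 * h * ℓ) * ∫ p, ‖X₀ p.1 - Y₀ p.2‖ ^ 2 ∂ρ
      + (h * τ + c ^ 2 * h ^ 2) * 2 * (∫ ω, R₁ ω ^ 2 ∂P + ∫ ω, R₂ ω ^ 2 ∂Q)
      + h * τ⁻¹ * 2 * (∫ ω, ‖h⁻¹ • (X₁ ω - X₀ ω) - vx ω‖ ^ 2 ∂P
          + ∫ ω, ‖h⁻¹ • (Y₁ ω - Y₀ ω) - vy ω‖ ^ 2 ∂Q) := by
  -- The re-randomization at the starting time: it leaves the cost of `(X₀, Y₀)` unchanged and makes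
  -- the term with `vx - Fx` vanish.
  obtain ⟨f, hf, hρ', hmap⟩ := exists_density_coupling hX₀ hY₀ hρ
  set ρ' := (P.prod Q).withDensity (fun p => f (X₀ p.1, Y₀ p.2)) with hρ'def
  have hsame : ∫ p, ‖X₀ p.1 - Y₀ p.2‖ ^ 2 ∂ρ = ∫ p, ‖X₀ p.1 - Y₀ p.2‖ ^ 2 ∂ρ' := by
    have hm : AEStronglyMeasurable (fun q : V × V => ‖q.1 - q.2‖ ^ 2)
        (ρ.map (Prod.map X₀ Y₀)) := by fun_prop
    have e1 := integral_map (hX₀.prodMap hY₀).aemeasurable hm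
    have hm' : AEStronglyMeasurable (fun q : V × V => ‖q.1 - q.2‖ ^ 2)
        (ρ'.map (Prod.map X₀ Y₀)) := by fun_prop
    have e2 := integral_map (hX₀.prodMap hY₀).aemeasurable hm'
    rw [hmap, e1] at e2
    exact e2
  have hD := memLp_comp_fst_sub_comp_snd hρ' hX₀2 hY₀2
  have hu : MemLp (fun p : Ω × Ω' => vx p.1 - Fx p.1) 2 ρ' := by
    have := hvx.sub hFx
    rw [← hρ'.2.1] at this
    exact this.comp_of_map measurable_fst.aemeasurable
  have hDu : Integrable (fun p : Ω × Ω' => inner ℝ (X₀ p.1 - Y₀ p.2) (vx p.1 - Fx p.1)) ρ' :=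
    hD.integrable_inner_of_memLp hu
  have hzero := integral_inner_eq_zero_of_density (Z := fun ω => vx ω - Fx ω) hX₀ hY₀ hf hρ'
    hDu hcond
  have iD := hD.integrable_norm_sq'
  have iR : Integrable (fun p : Ω × Ω' => (h * τ + c ^ 2 * h ^ 2) * 2 * R₁ p.1 ^ 2
      + (h * τ + c ^ 2 * h ^ 2) * 2 * R₂ p.2 ^ 2) ρ' :=
    ((integrable_comp_fst hρ' hR₁.integrable_sq).const_mul _).add
      ((integrable_comp_snd hρ' hR₂.integrable_sq).const_mul _)
  have iZ : Integrable (fun p : Ω × Ω' =>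
      h * τ⁻¹ * 2 * ‖h⁻¹ • (X₁ p.1 - X₀ p.1) - vx p.1‖ ^ 2
      + h * τ⁻¹ * 2 * ‖h⁻¹ • (Y₁ p.2 - Y₀ p.2) - vy p.2‖ ^ 2) ρ' :=
    ((integrable_comp_fst hρ' hZx).const_mul _).add ((integrable_comp_snd hρ' hZy).const_mul _)
  refine (transportCost_le hρ' _ _).trans ?_
  have key : ∫ p, ‖X₁ p.1 - Y₁ p.2‖ ^ 2 ∂ρ' ≤
      ∫ p, ((((1 + 2 * h * ℓ) * ‖X₀ p.1 - Y₀ p.2‖ ^ 2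
        + 2 * h * inner ℝ (X₀ p.1 - Y₀ p.2) (vx p.1 - Fx p.1))
        + ((h * τ + c ^ 2 * h ^ 2) * 2 * R₁ p.1 ^ 2
          + (h * τ + c ^ 2 * h ^ 2) * 2 * R₂ p.2 ^ 2))
        + (h * τ⁻¹ * 2 * ‖h⁻¹ • (X₁ p.1 - X₀ p.1) - vx p.1‖ ^ 2
          + h * τ⁻¹ * 2 * ‖h⁻¹ • (Y₁ p.2 - Y₀ p.2) - vy p.2‖ ^ 2)) ∂ρ' := by
    refine integral_mono_of_nonneg (Eventually.of_forall fun _ => by positivity)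
      ((((iD.const_mul _).add (hDu.const_mul _)).add iR).add iZ) ?_
    -- The Lipschitz bound is known almost everywhere for `P ⊗ Q` and passes to `ρ'` by absolute
    -- continuity.
    filter_upwards [ae_comp_fst hρ' h1, ae_comp_snd hρ' h2, hρ'.1.ae_le hlip] with p hp hq hl
    have e0 : X₁ p.1 - Y₁ p.2 = (X₀ p.1 - Y₀ p.2) + ((X₁ p.1 - X₀ p.1) - (Y₁ p.2 - Y₀ p.2)) := by
      abel
    have hexp := inner_expansion_le (D := X₀ p.1 - Y₀ p.2)
      (Δ := (X₁ p.1 - X₀ p.1) - (Y₁ p.2 - Y₀ p.2)) (u := vx p.1 - Fx p.1)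
      (w := Fx p.1 - vy p.2)
      (η := (h⁻¹ • (X₁ p.1 - X₀ p.1) - vx p.1) - (h⁻¹ • (Y₁ p.2 - Y₀ p.2) - vy p.2))
      hh hτ (by
        have : vx p.1 - Fx p.1 + (Fx p.1 - vy p.2) + ((h⁻¹ • (X₁ p.1 - X₀ p.1) - vx p.1)
            - (h⁻¹ • (Y₁ p.2 - Y₀ p.2) - vy p.2))
            = h⁻¹ • ((X₁ p.1 - X₀ p.1) - (Y₁ p.2 - Y₀ p.2)) := by
          rw [smul_sub h⁻¹ (X₁ p.1 - X₀ p.1)]; abel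
        rw [this, smul_smul, mul_inv_cancel₀ hh.ne', one_smul]) hl
    rw [← e0] at hexp
    refine hexp.trans ?_
    have b1 : ‖(h⁻¹ • (X₁ p.1 - X₀ p.1) - vx p.1) - (h⁻¹ • (Y₁ p.2 - Y₀ p.2) - vy p.2)‖ ^ 2
        ≤ 2 * ‖h⁻¹ • (X₁ p.1 - X₀ p.1) - vx p.1‖ ^ 2
          + 2 * ‖h⁻¹ • (Y₁ p.2 - Y₀ p.2) - vy p.2‖ ^ 2 := by
      have t1 := norm_sub_le (h⁻¹ • (X₁ p.1 - X₀ p.1) - vx p.1) (h⁻¹ • (Y₁ p.2 - Y₀ p.2) - vy p.2)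
      have t2 := pow_le_pow_left₀ (norm_nonneg _) t1 2
      nlinarith [sq_nonneg (‖h⁻¹ • (X₁ p.1 - X₀ p.1) - vx p.1‖
        - ‖h⁻¹ • (Y₁ p.2 - Y₀ p.2) - vy p.2‖)]
    have sqle : ∀ {a b : ℝ}, (a + b) ^ 2 ≤ 2 * a ^ 2 + 2 * b ^ 2 := fun {a b} => by
      nlinarith [sq_nonneg (a - b)]
    have b2 : ‖X₀ p.1 - Y₀ p.2‖ ^ 2 ≤ 2 * R₁ p.1 ^ 2 + 2 * R₂ p.2 ^ 2 := by
      refine le_trans ?_ sqle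
      gcongr
      exact (norm_sub_le _ _).trans (by linarith)
    have b3 : ‖(X₁ p.1 - X₀ p.1) - (Y₁ p.2 - Y₀ p.2)‖ ^ 2
        ≤ c ^ 2 * h ^ 2 * (2 * R₁ p.1 ^ 2 + 2 * R₂ p.2 ^ 2) := by
      have t0 : ‖(X₁ p.1 - X₀ p.1) - (Y₁ p.2 - Y₀ p.2)‖ ≤ c * h * R₁ p.1 + c * h * R₂ p.2 :=
        (norm_sub_le _ _).trans (by linarith [hp.2, hq.2])
      have t1 := pow_le_pow_left₀ (norm_nonneg _) t0 2
      have t2 := sqle (a := c * h * R₁ p.1) (b := c * h * R₂ p.2)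
      calc _ ≤ _ := t1.trans t2
        _ = _ := by ring
    have b1' := mul_le_mul_of_nonneg_left b1 (by positivity : 0 ≤ h * τ⁻¹)
    have b2' := mul_le_mul_of_nonneg_left b2 (by positivity : 0 ≤ h * τ)
    linarith
  refine key.trans (le_of_eq ?_)
  have jDu : Integrable (fun p : Ω × Ω' => (1 + 2 * h * ℓ) * ‖X₀ p.1 - Y₀ p.2‖ ^ 2
        + 2 * h * inner ℝ (X₀ p.1 - Y₀ p.2) (vx p.1 - Fx p.1)) ρ' :=
    (iD.const_mul _).add (hDu.const_mul _)
  have jR : Integrable (fun p : Ω × Ω' => (1 + 2 * h * ℓ) * ‖X₀ p.1 - Y₀ p.2‖ ^ 2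
        + 2 * h * inner ℝ (X₀ p.1 - Y₀ p.2) (vx p.1 - Fx p.1)
        + ((h * τ + c ^ 2 * h ^ 2) * 2 * R₁ p.1 ^ 2
          + (h * τ + c ^ 2 * h ^ 2) * 2 * R₂ p.2 ^ 2)) ρ' := jDu.add iR
  rw [integral_add jR iZ, integral_add jDu iR,
    integral_add (iD.const_mul _) (hDu.const_mul _), integral_const_mul, integral_const_mul,
    hzero, integral_comp_fst_add_comp_snd hρ' hR₁.integrable_sq hR₂.integrable_sq,
    integral_comp_fst_add_comp_snd hρ' hZx hZy, hsame]
  ring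

/-- The one-sided derivative of the transport cost along two random curves with velocities `vx`
and `vy`, the former with conditional expectation `Fx`. -/
lemma transportCost_slope_le {X₀ vx Fx : Ω → V} {Xn : ℕ → Ω → V} {Y₀ vy : Ω' → V}
    {Yn : ℕ → Ω' → V} {R₁ : Ω → ℝ} {R₂ : Ω' → ℝ} {h : ℕ → ℝ} {c ℓ : ℝ}
    (hX₀ : Measurable X₀) (hY₀ : Measurable Y₀)
    (hvx : AEStronglyMeasurable vx P) (hvy : AEStronglyMeasurable vy Q) (hFx : MemLp Fx 2 P)
    (hXn : ∀ᶠ n in atTop, Measurable (Xn n)) (hYn : ∀ᶠ n in atTop, Measurable (Yn n))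
    (hR₁ : MemLp R₁ 2 P) (hR₂ : MemLp R₂ 2 Q)
    (h1 : ∀ᵐ ω ∂P, ‖X₀ ω‖ ≤ R₁ ω) (h2 : ∀ᵐ ω ∂Q, ‖Y₀ ω‖ ≤ R₂ ω)
    (h1n : ∀ᶠ n in atTop, ∀ᵐ ω ∂P, ‖Xn n ω - X₀ ω‖ ≤ c * h n * R₁ ω)
    (h2n : ∀ᶠ n in atTop, ∀ᵐ ω ∂Q, ‖Yn n ω - Y₀ ω‖ ≤ c * h n * R₂ ω)
    (hlimx : ∀ᵐ ω ∂P, Tendsto (fun n => (h n)⁻¹ • (Xn n ω - X₀ ω)) atTop (𝓝 (vx ω)))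
    (hlimy : ∀ᵐ ω ∂Q, Tendsto (fun n => (h n)⁻¹ • (Yn n ω - Y₀ ω)) atTop (𝓝 (vy ω)))
    (hlip : ∀ᵐ p ∂P.prod Q, ‖Fx p.1 - vy p.2‖ ≤ ℓ * ‖X₀ p.1 - Y₀ p.2‖)
    (hcond : ∀ ψ : V → V, Measurable ψ →
      Integrable (fun ω => inner ℝ (ψ (X₀ ω)) (vx ω - Fx ω)) P →
      ∫ ω, inner ℝ (ψ (X₀ ω)) (vx ω - Fx ω) ∂P = 0)
    (hpos : ∀ᶠ n in atTop, 0 < h n) (hh : Tendsto h atTop (𝓝 0)) (hℓ : 0 ≤ ℓ)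
    {θ : ℝ} (hθ : 0 < θ) :
    ∀ᶠ n in atTop, transportCost P Q (Xn n) (Yn n) ≤ transportCost P Q X₀ Y₀
      + h n * (2 * ℓ * transportCost P Q X₀ Y₀ + θ) := by
  have hX₀2 : MemLp X₀ 2 P := hR₁.mono' hX₀.aestronglyMeasurable h1
  have hY₀2 : MemLp Y₀ 2 Q := hR₂.mono' hY₀.aestronglyMeasurable h2
  obtain ⟨hvx2, hZx, hTx⟩ := tendsto_integral_sq_slope_sub
    (hXn.mono fun n hn => hn.aestronglyMeasurable) hX₀.aestronglyMeasurable hvx hR₁ hpos h1n hlimx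
  obtain ⟨-, hZy, hTy⟩ := tendsto_integral_sq_slope_sub
    (hYn.mono fun n hn => hn.aestronglyMeasurable) hY₀.aestronglyMeasurable hvy hR₂ hpos h2n hlimy
  set M := 2 * (∫ ω, R₁ ω ^ 2 ∂P + ∫ ω, R₂ ω ^ 2 ∂Q) with hM
  have hM0 : 0 ≤ M := by positivity
  -- The Young weight is small enough that its contribution `τ * M` stays below `θ`; the remaining
  -- errors tend to zero.
  set τ := θ / (2 * (M + 1)) with hτ
  have hτ0 : 0 < τ := by positivity
  have hτM : τ * M < θ := by
    rw [hτ, div_mul_eq_mul_div, div_lt_iff₀ (by positivity)]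
    nlinarith
  have hlim : Tendsto (fun n => τ * M + c ^ 2 * h n * M
      + τ⁻¹ * 2 * (∫ ω, ‖(h n)⁻¹ • (Xn n ω - X₀ ω) - vx ω‖ ^ 2 ∂P
          + ∫ ω, ‖(h n)⁻¹ • (Yn n ω - Y₀ ω) - vy ω‖ ^ 2 ∂Q)) atTop (𝓝 (τ * M)) := by
    have := ((hh.const_mul (c ^ 2)).mul_const M).const_add (τ * M) |>.add
      ((hTx.add hTy).const_mul (τ⁻¹ * 2))
    simpa using this
  filter_upwards [hlim.eventually (gt_mem_nhds hτM), hpos, hZx, hZy, h1n, h2n]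
    with n hn hp hzx hzy hbx hby
  have hfac : 0 < 1 + 2 * h n * ℓ := by positivity
  -- All error terms depend on the marginals only, so the step bound is uniform in `ρ` and no
  -- optimal coupling is needed: the infimum is taken after division by the growth factor.
  have hle : (transportCost P Q (Xn n) (Yn n) - h n * θ) / (1 + 2 * h n * ℓ)
      ≤ transportCost P Q X₀ Y₀ := by
    refine le_transportCost fun ρ hρ => ?_
    rw [div_le_iff₀ hfac, sub_le_iff_le_add]
    refine (transportCost_le_of_coupling hX₀ hY₀ hX₀2 hY₀2 hvx2 hFx hR₁ hR₂ (h1.and hbx)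
      (h2.and hby) hlip hcond hzx hzy hp hτ0 hρ).trans ?_
    have := mul_le_mul_of_nonneg_left hn.le hp.le
    rw [hM] at this
    linarith
  rw [div_le_iff₀ hfac] at hle
  linarith

end Step

lemma tendsto_inv_smul_sub_of_hasDerivWithinAt {W : Type*} [NormedAddCommGroup W]
    [NormedSpace ℝ W] {f : ℝ → W} {f' : W} {s : ℝ} {h : ℕ → ℝ}
    (hf : HasDerivWithinAt f f' (Ici s) s) (hh : Tendsto h atTop (𝓝 0)) (hpos : ∀ n, 0 < h n) :
    Tendsto (fun n => (h n)⁻¹ • (f (s + h n) - f s)) atTop (𝓝 f') := by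
  rw [hasDerivWithinAt_iff_tendsto_slope] at hf
  have h1 : Tendsto (fun n => s + h n) atTop (𝓝[Ici s \ {s}] s) := by
    refine tendsto_nhdsWithin_iff.2 ⟨by simpa using hh.const_add s, ?_⟩
    refine Eventually.of_forall fun n => ⟨?_, ?_⟩
    · simp [(hpos n).le]
    · simp [(hpos n).ne']
  refine (hf.comp h1).congr fun n => ?_
  simp [slope_def_module]

/-! ### Equality of laws from the differential inequality for the cost. -/

section Uniqueness

variable {Ω Ω' : Type*} [MeasurableSpace Ω] [MeasurableSpace Ω']
  {P : Measure Ω} {Q : Measure Ω'} [IsProbabilityMeasure P] [IsProbabilityMeasure Q]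
  {V : Type*} [NormedAddCommGroup V] [InnerProductSpace ℝ V] [MeasurableSpace V] [BorelSpace V]
  [SecondCountableTopology V] [CompleteSpace V]

/-- Let `x` be a random curve whose velocity has conditional expectation `F t (x t)` given `x t`
at time `t`. Then every random curve `y` with velocity `F t (y t)` and the same initial law has
the same law as `x` at later times. -/
theorem map_eq_of_conditional_velocity {x v : ℝ → Ω → V} {y : ℝ → Ω' → V} {F : ℝ → V → V}
    {R₁ : Ω → ℝ} {R₂ : Ω' → ℝ} {k ℓ : ℝ → ℝ} {T : ℝ} (hT : 0 ≤ T)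
    (hk : IntervalIntegrable k volume 0 T) (hk0 : ∀ t ∈ Icc 0 T, 0 ≤ k t)
    (hℓ : IntervalIntegrable ℓ volume 0 T) (hℓ0 : ∀ t ∈ Icc 0 T, 0 ≤ ℓ t)
    (hxm : ∀ t ∈ Icc 0 T, Measurable (x t)) (hym : ∀ t ∈ Icc 0 T, Measurable (y t))
    (hR₁ : MemLp R₁ 2 P) (hR₂ : MemLp R₂ 2 Q)
    (hx : ∀ᵐ ω ∂P, ∀ t ∈ Icc 0 T, ‖x t ω‖ ≤ R₁ ω)
    (hy : ∀ᵐ ω ∂Q, ∀ t ∈ Icc 0 T, ‖y t ω‖ ≤ R₂ ω)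
    (hxi : ∀ᵐ ω ∂P, ∀ s ∈ Icc 0 T, ∀ t ∈ Icc s T, ‖x t ω - x s ω‖ ≤ (∫ r in s..t, k r) * R₁ ω)
    (hyi : ∀ᵐ ω ∂Q, ∀ s ∈ Icc 0 T, ∀ t ∈ Icc s T, ‖y t ω - y s ω‖ ≤ (∫ r in s..t, k r) * R₂ ω)
    (hvm : ∀ᵐ s, s ∈ Ioo 0 T → AEStronglyMeasurable (v s) P)
    (hFy : ∀ᵐ s, s ∈ Ioo 0 T → AEStronglyMeasurable (fun ω => F s (y s ω)) Q)
    (hFx : ∀ᵐ s, s ∈ Ioo 0 T → MemLp (fun ω => F s (x s ω)) 2 P)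
    (hdx : ∀ᵐ s, s ∈ Ioo 0 T →
      ∀ᵐ ω ∂P, HasDerivWithinAt (fun t => x t ω) (v s ω) (Ici s) s)
    (hdy : ∀ᵐ s, s ∈ Ioo 0 T →
      ∀ᵐ ω ∂Q, Tendsto (fun n : ℕ => (1 / ((n : ℝ) + 1))⁻¹ • (y (s + 1 / ((n : ℝ) + 1)) ω - y s ω))
        atTop (𝓝 (F s (y s ω))))
    (hlip : ∀ᵐ s, s ∈ Ioo 0 T → ∀ᵐ p ∂P.prod Q,
      ‖F s (x s p.1) - F s (y s p.2)‖ ≤ ℓ s * ‖x s p.1 - y s p.2‖)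
    (hcond : ∀ᵐ s, s ∈ Ioo 0 T → ∀ ψ : V → V, Measurable ψ →
      Integrable (fun ω => inner ℝ (ψ (x s ω)) (v s ω - F s (x s ω))) P →
      ∫ ω, inner ℝ (ψ (x s ω)) (v s ω - F s (x s ω)) ∂P = 0)
    (hinit : P.map (x 0) = Q.map (y 0)) :
    P.map (x T) = Q.map (y T) := by
  have hT0 : (0 : ℝ) ∈ Icc 0 T := ⟨le_rfl, hT⟩
  have hTT : T ∈ Icc 0 T := ⟨hT, le_rfl⟩
  have hx2 : ∀ t ∈ Icc 0 T, MemLp (x t) 2 P := fun t ht =>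
    hR₁.mono' (hxm t ht).aestronglyMeasurable (hx.mono fun ω h => h t ht)
  have hy2 : ∀ t ∈ Icc 0 T, MemLp (y t) 2 Q := fun t ht =>
    hR₂.mono' (hym t ht).aestronglyMeasurable (hy.mono fun ω h => h t ht)
  refine map_eq_of_transportCost_eq_zero (hxm T hTT) (hym T hTT) (hx2 T hTT) (hy2 T hTT) ?_
  set w : ℝ → ℝ := fun t => transportCost P Q (x t) (y t) with hw
  have hw0 : w 0 = 0 := transportCost_eq_zero_of_map_eq (hxm 0 hT0) (hym 0 hT0) hinit
  set M := ∫ ω, R₁ ω ^ 2 ∂P + ∫ ω, R₂ ω ^ 2 ∂Q with hM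
  have hkst : ∀ s ∈ Icc 0 T, ∀ t ∈ Icc s T, IntervalIntegrable k volume s t := fun s hs t ht =>
    hk.mono_set (by
      rw [uIcc_of_le ht.1, uIcc_of_le hT]
      exact Icc_subset_Icc hs.1 ht.2)
  have hk0st : ∀ s ∈ Icc 0 T, ∀ t ∈ Icc s T, 0 ≤ ∫ r in s..t, k r := fun s hs t ht =>
    intervalIntegral.integral_nonneg ht.1 fun u hu => hk0 u ⟨hs.1.trans hu.1, hu.2.trans ht.2⟩
  -- The cost is Lipschitz with respect to the primitive of `k`, hence absolutely continuous. The
  -- two signs follow by exchanging the roles of `s` and `t`.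
  have hstep : ∀ s ∈ Icc 0 T, ∀ t ∈ Icc s T, |w t - w s| ≤ 4 * M * ∫ r in s..t, k r := by
    intro s hs t ht
    have ht' : t ∈ Icc 0 T := ⟨hs.1.trans ht.1, ht.2⟩
    have hc := hk0st s hs t ht
    rw [abs_sub_le_iff]
    constructor
    · have := transportCost_le_add (X₁ := x t) (Y₁ := y t) (hx2 s hs) (hy2 s hs) hR₁ hR₂
        (by filter_upwards [hx, hxi] with ω h1 h2 using ⟨h1 s hs, h1 t ht', h2 s hs t ht⟩)
        (by filter_upwards [hy, hyi] with ω h1 h2 using ⟨h1 s hs, h1 t ht', h2 s hs t ht⟩) hc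
      simp only [hw]
      linarith
    · have := transportCost_le_add (X₁ := x s) (Y₁ := y s) (hx2 t ht') (hy2 t ht') hR₁ hR₂
        (by
          filter_upwards [hx, hxi] with ω h1 h2
          exact ⟨h1 t ht', h1 s hs, by rw [norm_sub_rev]; exact h2 s hs t ht⟩)
        (by
          filter_upwards [hy, hyi] with ω h1 h2
          exact ⟨h1 t ht', h1 s hs, by rw [norm_sub_rev]; exact h2 s hs t ht⟩) hc
      simp only [hw]
      linarith
  have hsub : ∀ s ∈ Icc 0 T, ∀ t ∈ Icc s T,
      (∫ r in (0 : ℝ)..t, k r) - ∫ r in (0 : ℝ)..s, k r = ∫ r in s..t, k r := fun s hs t ht =>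
    intervalIntegral.integral_interval_sub_left
      (hkst 0 hT0 t ⟨hs.1.trans ht.1, ht.2⟩) (hkst 0 hT0 s hs)
  have hac : AbsolutelyContinuousOnInterval w 0 T := by
    refine absolutelyContinuous_of_dist_le (C := 4 * M)
      (hk.absolutelyContinuousOnInterval_intervalIntegral (c := 0) (by simp)) ?_
    rw [uIcc_of_le hT]
    intro s hs t ht
    rw [Real.dist_eq, Real.dist_eq]
    rcases le_total s t with hst | hst
    · rw [abs_sub_comm, abs_sub_comm (∫ r in (0 : ℝ)..s, k r), hsub s hs t ⟨hst, ht.2⟩,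
        abs_of_nonneg (hk0st s hs t ⟨hst, ht.2⟩)]
      exact hstep s hs t ⟨hst, ht.2⟩
    · rw [hsub t ht s ⟨hst, hs.2⟩, abs_of_nonneg (hk0st t ht s ⟨hst, hs.2⟩)]
      exact hstep t ht s ⟨hst, hs.2⟩
  have hgron := le_mul_exp_of_ae_deriv_le hT hac (hℓ.const_mul 2)
    (fun t ht => by have := hℓ0 t ht; positivity) (by
      filter_upwards [hk.ae_hasDerivAt_integral, hvm, hFy, hFx, hdx, hdy, hlip, hcond]
        with s hks hvms hFys hFxs hdxs hdys hlips hconds hs g' hg'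
      have hsI : s ∈ Icc 0 T := Ioo_subset_Icc_self hs
      -- The derivative of `w` at `s`, when it exists, can be read off along one sequence of steps,
      -- and `hdy` provides the velocity of `y` along this one.
      set h : ℕ → ℝ := fun n => 1 / ((n : ℝ) + 1) with hh
      have hpos : ∀ n, 0 < h n := fun n => by positivity
      have hlim : Tendsto h atTop (𝓝 0) := tendsto_one_div_add_atTop_nhds_zero_nat
      have hev : ∀ᶠ n in atTop, s + h n ∈ Icc s T := by
        have : ∀ᶠ n in atTop, h n < T - s := hlim.eventually (gt_mem_nhds (by linarith [hs.2]))
        filter_upwards [this] with n hn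
        exact ⟨by linarith [hpos n], by linarith⟩
      have hev' : ∀ᶠ n in atTop, s + h n ∈ Icc 0 T :=
        hev.mono fun n hn => ⟨hs.1.le.trans hn.1, hn.2⟩
      have hκd := tendsto_inv_smul_sub_of_hasDerivWithinAt
        (hks (by rwa [uIcc_of_le hT]) 0 (by simp)).hasDerivWithinAt hlim hpos
      -- Differentiability of the primitive at `s` turns the integral bounds on increments into
      -- linear ones, with constant `k s + 1`.
      have hκb : ∀ᶠ n in atTop, ∫ r in s..(s + h n), k r ≤ (k s + 1) * h n := by
        filter_upwards [hκd.eventually (gt_mem_nhds (lt_add_one (k s))), hev] with n hn hn2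
        rw [hsub s hsI _ hn2, smul_eq_mul, inv_mul_lt_iff₀ (hpos n)] at hn
        linarith
      have hwd := tendsto_inv_smul_sub_of_hasDerivWithinAt hg'.hasDerivWithinAt hlim hpos
      refine le_of_forall_pos_le_add fun θ hθ => le_of_tendsto hwd ?_
      have hslope := transportCost_slope_le (Xn := fun n => x (s + h n))
        (Yn := fun n => y (s + h n)) (hxm s hsI) (hym s hsI) (hvms hs) (hFys hs) (hFxs hs)
        (hev'.mono fun n hn => hxm _ hn) (hev'.mono fun n hn => hym _ hn) hR₁ hR₂
        (hx.mono fun ω hω => hω s hsI) (hy.mono fun ω hω => hω s hsI)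
        (c := k s + 1) (h := h) (by
          filter_upwards [hκb, hev] with n hn hn2
          filter_upwards [hx, hxi] with ω h1 h2
          have := (norm_nonneg _).trans (h1 s hsI)
          exact (h2 s hsI _ hn2).trans (by gcongr))
        (by
          filter_upwards [hκb, hev] with n hn hn2
          filter_upwards [hy, hyi] with ω h1 h2
          have := (norm_nonneg _).trans (h1 s hsI)
          exact (h2 s hsI _ hn2).trans (by gcongr))
        ((hdxs hs).mono fun ω hω => tendsto_inv_smul_sub_of_hasDerivWithinAt hω hlim hpos)
        (hdys hs)
        (hlips hs) (hconds hs) (Eventually.of_forall hpos) hlim (hℓ0 s hsI) hθ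
      filter_upwards [hslope] with n hn
      rw [smul_eq_mul, inv_mul_le_iff₀ (hpos n)]
      simp only [hw]
      linarith)
  rw [hw0, zero_mul] at hgron
  exact le_antisymm hgron (transportCost_nonneg _ _)

end Uniqueness

/-! ### Conditional expectations computed from a disintegration. -/

section Disintegration

variable {α β : Type*} [MeasurableSpace α] [MeasurableSpace β] {μ : Measure α}
  {A : α → β} {κ : Kernel β α} {V : Type*} [NormedAddCommGroup V]

lemma aestronglyMeasurable_snd_of_disintegration {f : α → V} (hA : Measurable A)
    (hκ : (μ.map A) ⊗ₘ κ = μ.map fun x => (A x, x)) (hf : AEStronglyMeasurable f μ) :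
    AEStronglyMeasurable (fun q : β × α => f q.2) ((μ.map A) ⊗ₘ κ) := by
  refine AEStronglyMeasurable.comp_measurable (f := Prod.snd) (g := f) ?_ measurable_snd
  rw [hκ, Measure.map_map measurable_snd (by fun_prop)]
  change AEStronglyMeasurable f (μ.map id)
  rwa [Measure.map_id]

lemma integrable_snd_of_disintegration {f : α → V} (hA : Measurable A)
    (hκ : (μ.map A) ⊗ₘ κ = μ.map fun x => (A x, x)) (hf : Integrable f μ) :
    Integrable (fun q : β × α => f q.2) ((μ.map A) ⊗ₘ κ) := by
  have hm := aestronglyMeasurable_snd_of_disintegration hA hκ hf.1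
  rw [hκ] at hm ⊢
  rwa [integrable_map_measure hm (hA.prodMk measurable_id).aemeasurable]

variable [IsProbabilityMeasure μ] [IsMarkovKernel κ]

lemma aestronglyMeasurable_fst_of_disintegration {g : β → V}
    (hg : AEStronglyMeasurable g (μ.map A)) (hA : Measurable A) :
    AEStronglyMeasurable (fun q : β × α => g q.1) ((μ.map A) ⊗ₘ κ) := by
  have : IsProbabilityMeasure (μ.map A) := Measure.isProbabilityMeasure_map hA.aemeasurable
  refine AEStronglyMeasurable.comp_measurable (f := Prod.fst) (g := g) ?_ measurable_fst
  rwa [← Measure.fst, Measure.fst_compProd]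

lemma ae_integrable_of_disintegration {f : α → V} (hA : Measurable A)
    (hκ : (μ.map A) ⊗ₘ κ = μ.map fun x => (A x, x)) (hf : Integrable f μ) :
    ∀ᵐ y ∂(μ.map A), Integrable f (κ y) := by
  have : IsProbabilityMeasure (μ.map A) := Measure.isProbabilityMeasure_map hA.aemeasurable
  have h := integrable_snd_of_disintegration hA hκ hf
  exact ((Measure.integrable_compProd_iff h.1).1 h).1

variable [NormedSpace ℝ V]

lemma aestronglyMeasurable_integral_of_disintegration {f : α → V} (hA : Measurable A)
    (hκ : (μ.map A) ⊗ₘ κ = μ.map fun x => (A x, x)) (hf : AEStronglyMeasurable f μ) :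
    AEStronglyMeasurable (fun y => ∫ x, f x ∂κ y) (μ.map A) := by
  have : IsProbabilityMeasure (μ.map A) := Measure.isProbabilityMeasure_map hA.aemeasurable
  have h := aestronglyMeasurable_snd_of_disintegration hA hκ hf
  exact h.integral_kernel_compProd

/-- The tower property: Fubini for the composition-product, which `hκ` identifies with the law of
`(A x, x)`. -/
lemma integral_integral_of_disintegration {f : α → V} (hA : Measurable A)
    (hκ : (μ.map A) ⊗ₘ κ = μ.map fun x => (A x, x)) (hf : Integrable f μ) :
    Integrable (fun y => ∫ x, f x ∂κ y) (μ.map A) ∧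
      ∫ y, ∫ x, f x ∂κ y ∂(μ.map A) = ∫ x, f x ∂μ := by
  have : IsProbabilityMeasure (μ.map A) := Measure.isProbabilityMeasure_map hA.aemeasurable
  have h := integrable_snd_of_disintegration hA hκ hf
  refine ⟨((Measure.integrable_compProd_iff h.1).1 h).2.mono'
    (aestronglyMeasurable_integral_of_disintegration hA hκ hf.1)
    (Eventually.of_forall fun _ => norm_integral_le_integral_norm _), ?_⟩
  rw [← Measure.integral_compProd h]
  have hm := h.1
  rw [hκ] at hm ⊢
  exact integral_map (hA.prodMk measurable_id).aemeasurable hm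

lemma integral_norm_integral_le_of_disintegration {f : α → V} (hA : Measurable A)
    (hκ : (μ.map A) ⊗ₘ κ = μ.map fun x => (A x, x)) (hf : Integrable f μ) :
    ∫ y, ‖∫ x, f x ∂κ y‖ ∂(μ.map A) ≤ ∫ x, ‖f x‖ ∂μ := by
  obtain ⟨h1, h2⟩ := integral_integral_of_disintegration hA hκ hf.norm
  rw [← h2]
  exact integral_mono_of_nonneg (Eventually.of_forall fun _ => norm_nonneg _) h1
    (Eventually.of_forall fun _ => norm_integral_le_integral_norm _)

/-- Jensen's inequality, read off from the nonnegative variance of `‖f‖`. -/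
lemma sq_norm_integral_le {ν : Measure α} [IsProbabilityMeasure ν] {f : α → V}
    (hf : Integrable f ν) (hf2 : Integrable (fun x => ‖f x‖ ^ 2) ν) :
    ‖∫ x, f x ∂ν‖ ^ 2 ≤ ∫ x, ‖f x‖ ^ 2 ∂ν := by
  set a := ∫ x, ‖f x‖ ∂ν with ha
  have h1 : ‖∫ x, f x ∂ν‖ ≤ a := norm_integral_le_integral_norm _
  have h2 : 0 ≤ ∫ x, (‖f x‖ ^ 2 - 2 * a * ‖f x‖ + a ^ 2) ∂ν :=
    integral_nonneg fun x => by
      have := sq_nonneg (‖f x‖ - a)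
      simp only [Pi.zero_apply]
      linarith
  have i1 : Integrable (fun x => ‖f x‖ ^ 2 - 2 * a * ‖f x‖) ν := hf2.sub (hf.norm.const_mul _)
  rw [integral_add i1 (integrable_const _), integral_sub hf2 (hf.norm.const_mul _),
    integral_const_mul, ← ha] at h2
  simp only [integral_const, probReal_univ, one_smul] at h2
  have := pow_le_pow_left₀ (norm_nonneg _) h1 2
  linarith

lemma memLp_integral_of_disintegration {f : α → V} (hA : Measurable A)
    (hκ : (μ.map A) ⊗ₘ κ = μ.map fun x => (A x, x)) (hf : MemLp f 2 μ) :
    MemLp (fun y => ∫ x, f x ∂κ y) 2 (μ.map A) := by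
  have hi := hf.integrable (by norm_num)
  rw [memLp_two_iff_integrable_sq_norm
    (aestronglyMeasurable_integral_of_disintegration hA hκ hf.1)]
  refine (integral_integral_of_disintegration hA hκ hf.integrable_norm_sq').1.mono'
    ((aestronglyMeasurable_integral_of_disintegration hA hκ hf.1).norm.pow 2) ?_
  filter_upwards [ae_integrable_of_disintegration hA hκ hi,
    ae_integrable_of_disintegration hA hκ hf.integrable_norm_sq'] with y h1 h2
  rw [Real.norm_of_nonneg (by positivity)]
  exact sq_norm_integral_le h1 h2

end Disintegration

section Projection

variable {α β : Type*} [MeasurableSpace α] [MeasurableSpace β] {μ : Measure α}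
  [IsProbabilityMeasure μ] {A : α → β} {κ : Kernel β α} [IsMarkovKernel κ]
  {V : Type*} [NormedAddCommGroup V] [InnerProductSpace ℝ V] [CompleteSpace V]

/-- Given `A = y` the factor `ψ y` is constant and `f` minus its conditional mean integrates to
zero. Only the product is assumed integrable, which admits the unbounded `ψ` built from a coupling
density. -/
lemma integral_inner_sub_eq_zero_of_disintegration {f : α → V} {ψ : β → V} (hA : Measurable A)
    (hκ : (μ.map A) ⊗ₘ κ = μ.map fun x => (A x, x)) (hf : Integrable f μ)
    (hψ : AEStronglyMeasurable ψ (μ.map A))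
    (hint : Integrable (fun x => inner ℝ (ψ (A x)) (f x - ∫ x', f x' ∂κ (A x))) μ) :
    ∫ x, inner ℝ (ψ (A x)) (f x - ∫ x', f x' ∂κ (A x)) ∂μ = 0 := by
  have : IsProbabilityMeasure (μ.map A) := Measure.isProbabilityMeasure_map hA.aemeasurable
  have hm : AEStronglyMeasurable
      (fun q : β × α => inner ℝ (ψ q.1) (f q.2 - ∫ x', f x' ∂κ q.1)) ((μ.map A) ⊗ₘ κ) :=
    (aestronglyMeasurable_fst_of_disintegration hψ hA).inner
      ((aestronglyMeasurable_snd_of_disintegration hA hκ hf.1).sub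
        (aestronglyMeasurable_fst_of_disintegration
          (aestronglyMeasurable_integral_of_disintegration hA hκ hf.1) hA))
  have hAm : AEMeasurable (fun x => (A x, x)) μ := (hA.prodMk measurable_id).aemeasurable
  have hm' := hm
  rw [hκ] at hm'
  have hi : Integrable (fun q : β × α => inner ℝ (ψ q.1) (f q.2 - ∫ x', f x' ∂κ q.1))
      ((μ.map A) ⊗ₘ κ) := by
    rw [hκ, integrable_map_measure hm' hAm]
    exact hint
  have e1 := integral_map hAm hm'
  rw [← hκ, Measure.integral_compProd hi] at e1
  rw [← e1]
  refine integral_eq_zero_of_ae ?_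
  filter_upwards [ae_integrable_of_disintegration hA hκ hf] with y hy
  simp only [Pi.zero_apply]
  have hs : Integrable (fun b => f b - ∫ x', f x' ∂κ y) (κ y) := hy.sub (integrable_const _)
  rw [integral_inner hs, integral_sub hy (integrable_const _)]
  simp

end Projection

/-- Conditional expectations computed from a disintegration are optimal projections. -/
lemma isOptimalProjection_of_disintegration {m N : ℕ} {V : Type*} [NormedAddCommGroup V]
    [InnerProductSpace ℝ V] [CompleteSpace V] {μ : Measure (E N)} [IsProbabilityMeasure μ]
    {A : E N → E m} {κ : Kernel (E m) (E N)} [IsMarkovKernel κ] {f : E N → V}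
    (hA : Measurable A) (hκ : (μ.map A) ⊗ₘ κ = μ.map fun x => (A x, x)) (hf : MemLp f 2 μ) :
    IsOptimalProjection μ A f (fun y => ∫ x, f x ∂κ y) := by
  set p : E m → V := fun y => ∫ x, f x ∂κ y with hp
  have hpL : MemLp p 2 (μ.map A) := memLp_integral_of_disintegration hA hκ hf
  have hpA : MemLp (fun x => p (A x)) 2 μ := hpL.comp_of_map hA.aemeasurable
  have horth : ∀ g : E m → V, MemLp g 2 (μ.map A) →
      ∫ x, inner ℝ (f x - p (A x)) (g (A x)) ∂μ = 0 := fun g hg => by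
    simp_rw [real_inner_comm]
    exact integral_inner_sub_eq_zero_of_disintegration hA hκ (hf.integrable (by norm_num)) hg.1
      ((hg.comp_of_map hA.aemeasurable).integrable_inner_of_memLp (hf.sub hpA))
  -- The Pythagorean identity yields minimality and, from its last term, uniqueness.
  have hpyth : ∀ g : E m → V, MemLp g 2 (μ.map A) →
      ∫ x, ‖f x - g (A x)‖ ^ 2 ∂μ = ∫ x, ‖f x - p (A x)‖ ^ 2 ∂μ
        + ∫ y, ‖p y - g y‖ ^ 2 ∂(μ.map A) := fun g hg => by
    have hgA : MemLp (fun x => g (A x)) 2 μ := hg.comp_of_map hA.aemeasurable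
    have i1 : Integrable (fun x => ‖f x - p (A x)‖ ^ 2) μ := (hf.sub hpA).integrable_norm_sq'
    have i2 : Integrable (fun x => inner ℝ (f x - p (A x)) (p (A x) - g (A x))) μ :=
      (hf.sub hpA).integrable_inner_of_memLp (hpA.sub hgA)
    have i3 : Integrable (fun x => ‖p (A x) - g (A x)‖ ^ 2) μ :=
      (hpA.sub hgA).integrable_norm_sq'
    have e : ∀ x, ‖f x - g (A x)‖ ^ 2 = ‖f x - p (A x)‖ ^ 2
        + 2 * inner ℝ (f x - p (A x)) (p (A x) - g (A x)) + ‖p (A x) - g (A x)‖ ^ 2 := fun x => by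
      rw [← norm_add_sq_real, sub_add_sub_cancel]
    have i12 : Integrable (fun x => ‖f x - p (A x)‖ ^ 2
        + 2 * inner ℝ (f x - p (A x)) (p (A x) - g (A x))) μ := i1.add (i2.const_mul _)
    have hz : ∫ x, inner ℝ (f x - p (A x)) (p (A x) - g (A x)) ∂μ = 0 :=
      horth (p - g) (hpL.sub hg)
    have hm : AEStronglyMeasurable (fun y => ‖p y - g y‖ ^ 2) (μ.map A) :=
      (hpL.1.sub hg.1).norm.pow 2
    rw [integral_map hA.aemeasurable hm]
    simp_rw [e]
    rw [integral_add i12 i3, integral_add i1 (i2.const_mul _), integral_const_mul, hz]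
    simp
  refine ⟨hf, hpL, horth, fun g hg => ?_, fun g hg hle => ?_⟩
  · rw [hpyth g hg]
    have : 0 ≤ ∫ y, ‖p y - g y‖ ^ 2 ∂(μ.map A) := integral_nonneg fun _ => by positivity
    linarith
  · rw [hpyth g hg] at hle
    have h0 : ∫ y, ‖p y - g y‖ ^ 2 ∂(μ.map A) = 0 :=
      le_antisymm (by linarith) (integral_nonneg fun _ => by positivity)
    have hi : Integrable (fun y => ‖p y - g y‖ ^ 2) (μ.map A) := (hpL.sub hg).integrable_norm_sq'
    rw [integral_eq_zero_iff_of_nonneg (fun _ => by positivity) hi] at h0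
    filter_upwards [h0] with y hy
    simp only [Pi.zero_apply, ne_eq, OfNat.ofNat_ne_zero, not_false_eq_true, pow_eq_zero_iff,
      norm_eq_zero, sub_eq_zero] at hy
    exact hy.symm

/-! ### Lipschitz dependence of integrals on the measure. -/

/-- The integral of a Lipschitz function depends on the measure in a Lipschitz way for the
Wasserstein distance, and integrability is preserved at finite distance. -/
lemma integral_lipschitz_of_wasserstein1_le {n : ℕ} {W : Type*} [NormedAddCommGroup W]
    [NormedSpace ℝ W] [SecondCountableTopology W] {Γ : Set (E n)} {f : E n → W}
    {L B : ℝ≥0} (hΓ : MeasurableSet Γ) (hf : LipschitzOnWith L f Γ) {μ ν : Measure (E n)}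
    (hμ : μ Γᶜ = 0) (hν : ν Γᶜ = 0) (hW : wasserstein1 μ ν ≤ B) (hi : Integrable f μ) :
    Integrable f ν ∧ ‖(∫ x, f x ∂μ) - ∫ x, f x ∂ν‖ ≤ L * B := by
  have hmeas : ∀ {ξ : Measure (E n)}, ξ Γᶜ = 0 → AEStronglyMeasurable f ξ := fun {ξ} hξ => by
    have h1 : ξ.restrict Γ = ξ := Measure.restrict_eq_self_of_ae_mem (mem_ae_iff.2 hξ)
    rw [← h1]
    exact hf.continuousOn.aestronglyMeasurable hΓ
  -- Near-optimal couplings are enough; the excess `ε` is removed at the end.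
  have hex : ∀ ε : ℝ≥0, 0 < ε → ∃ π : Measure (E n × E n), π.map Prod.fst = μ ∧
      π.map Prod.snd = ν ∧ ∫⁻ p, edist p.1 p.2 ∂π < (B + ε : ℝ≥0) := fun ε hε => by
    have : wasserstein1 μ ν < (B + ε : ℝ≥0) :=
      hW.trans_lt (by exact_mod_cast lt_add_of_pos_right B hε)
    simp only [wasserstein1, iInf_lt_iff] at this
    obtain ⟨π, h1, h2, h3⟩ := this
    exact ⟨π, h1, h2, h3⟩
  have hmain : ∀ ε : ℝ≥0, 0 < ε →
      Integrable f ν ∧ ‖(∫ x, f x ∂μ) - ∫ x, f x ∂ν‖ ≤ L * (B + ε) := fun ε hε => by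
    obtain ⟨π, h1, h2, h3⟩ := hex ε hε
    have hfm : AEStronglyMeasurable f (π.map Prod.fst) := h1 ▸ hmeas hμ
    have hsm : AEStronglyMeasurable f (π.map Prod.snd) := h2 ▸ hmeas hν
    have hf1 : AEStronglyMeasurable (fun p : E n × E n => f p.1) π :=
      hfm.comp_measurable measurable_fst
    have hf2 : AEStronglyMeasurable (fun p : E n × E n => f p.2) π :=
      hsm.comp_measurable measurable_snd
    have hm1 : ∀ᵐ p ∂π, p.1 ∈ Γ := by
      have : ∀ᵐ x ∂(π.map Prod.fst), x ∈ Γ := h1 ▸ mem_ae_iff.2 hμ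
      exact ae_of_ae_map measurable_fst.aemeasurable this
    have hm2 : ∀ᵐ p ∂π, p.2 ∈ Γ := by
      have : ∀ᵐ x ∂(π.map Prod.snd), x ∈ Γ := h2 ▸ mem_ae_iff.2 hν
      exact ae_of_ae_map measurable_snd.aemeasurable this
    have hle : ∫⁻ p, ‖f p.1 - f p.2‖ₑ ∂π ≤ (L * (B + ε) : ℝ≥0) := by
      calc ∫⁻ p, ‖f p.1 - f p.2‖ₑ ∂π ≤ ∫⁻ p, L * edist p.1 p.2 ∂π := by
            refine lintegral_mono_ae ?_
            filter_upwards [hm1, hm2] with p hp hq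
            rw [← edist_eq_enorm_sub]
            exact hf hp hq
        _ = L * ∫⁻ p, edist p.1 p.2 ∂π := lintegral_const_mul _ (by fun_prop)
        _ ≤ (L * (B + ε) : ℝ≥0) := by
            rw [ENNReal.coe_mul]
            gcongr
    -- Finite transport cost makes the difference integrable, which carries integrability of `f`
    -- from `μ` to `ν`.
    have hd : Integrable (fun p : E n × E n => f p.1 - f p.2) π :=
      ⟨hf1.sub hf2, hle.trans_lt ENNReal.coe_lt_top⟩
    have hi1 : Integrable (fun p : E n × E n => f p.1) π :=
      (integrable_map_measure hfm measurable_fst.aemeasurable).1 (h1 ▸ hi)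
    have hi2 : Integrable (fun p : E n × E n => f p.2) π := by
      have := hi1.sub hd
      refine this.congr (Eventually.of_forall fun p => ?_)
      simp
    have hν' : Integrable f ν := by
      rw [← h2]
      exact (integrable_map_measure hsm measurable_snd.aemeasurable).2 hi2
    refine ⟨hν', ?_⟩
    have e1 : ∫ x, f x ∂μ = ∫ p, f p.1 ∂π := by
      rw [← h1]; exact integral_map measurable_fst.aemeasurable hfm
    have e2 : ∫ x, f x ∂ν = ∫ p, f p.2 ∂π := by
      rw [← h2]; exact integral_map measurable_snd.aemeasurable hsm
    rw [e1, e2, ← integral_sub hi1 hi2]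
    have h4 := (enorm_integral_le_lintegral_enorm (μ := π) fun p : E n × E n =>
      f p.1 - f p.2).trans hle
    rw [enorm_le_coe] at h4
    exact_mod_cast h4
  refine ⟨(hmain 1 one_pos).1, le_of_forall_pos_le_add fun δ hδ => ?_⟩
  obtain ⟨ε, hε⟩ : ∃ ε : ℝ≥0, (ε : ℝ) = δ / (L + 1) :=
    ⟨(δ / (L + 1)).toNNReal, Real.coe_toNNReal _ (by positivity)⟩
  have hε0 : 0 < ε := NNReal.coe_pos.1 (by rw [hε]; positivity)
  refine (hmain ε hε0).2.trans ?_
  have : (L : ℝ) * (δ / (L + 1)) ≤ δ := by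
    rw [mul_div_assoc', div_le_iff₀ (by positivity)]
    nlinarith [L.coe_nonneg]
  rw [hε]
  linarith

/-! ### A priori bounds for paths, and exchanging almost every time with almost every path. -/

section Curves

/-- A priori bounds for solutions of an autonomous equation with a Lipschitz vector field. -/
lemma norm_le_of_hasDerivWithinAt_lipschitz {W : Type*} [NormedAddCommGroup W] [NormedSpace ℝ W]
    {Γ : Set W} {b : W → W} {L : ℝ≥0} (hb : LipschitzOnWith L b Γ) {f : ℝ → W} {T : ℝ}
    (hmem : ∀ t, 0 ≤ t → f t ∈ Γ)
    (hode : ∀ t, 0 ≤ t → HasDerivWithinAt f (b (f t)) (Ici 0) t) :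
    (∀ t ∈ Icc 0 T, ‖b (f t)‖ ≤ ‖b (f 0)‖ * Real.exp ((L + 1) * T)) ∧
    ∀ s ∈ Icc 0 T, ∀ t ∈ Icc s T,
      ‖f t - f s‖ ≤ ‖b (f 0)‖ * Real.exp ((L + 1) * T) * (t - s) := by
  -- The rate `L + 1` instead of `L` is nonzero, so one closed form of the Grönwall bound covers all
  -- cases.
  have hL : (0 : ℝ) < L + 1 := by positivity
  have hlip : ∀ t, 0 ≤ t → ‖b (f t)‖ ≤ (L + 1) * ‖f t - f 0‖ + ‖b (f 0)‖ := fun t ht => by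
    have h1 := hb.norm_sub_le (hmem t ht) (hmem 0 le_rfl)
    have h2 : ‖b (f t)‖ ≤ ‖b (f t) - b (f 0)‖ + ‖b (f 0)‖ := by
      simpa using norm_add_le (b (f t) - b (f 0)) (b (f 0))
    nlinarith [norm_nonneg (f t - f 0)]
  have hbd : ∀ t ∈ Icc 0 T, ‖b (f t)‖ ≤ ‖b (f 0)‖ * Real.exp ((L + 1) * T) := fun t ht => by
    have hg := norm_le_gronwallBound_of_norm_deriv_right_le (f := fun t => f t - f 0)
      (f' := fun t => b (f t)) (δ := 0) (K := L + 1) (ε := ‖b (f 0)‖) (a := 0) (b := T)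
      (fun s hs => (((hode s hs.1).continuousWithinAt).mono Icc_subset_Ici_self).sub
        continuousWithinAt_const)
      (fun s hs => ((hode s hs.1).mono (Ici_subset_Ici.2 hs.1)).sub_const _)
      (by simp) (fun s hs => hlip s hs.1) t ht
    simp only [gronwallBound_of_K_ne_0 hL.ne', zero_mul, zero_add, sub_zero] at hg
    have h3 := mul_le_mul_of_nonneg_left hg hL.le
    have h4 : ((L : ℝ) + 1) * (‖b (f 0)‖ / (L + 1) * (Real.exp ((L + 1) * t) - 1))
        = ‖b (f 0)‖ * Real.exp ((L + 1) * t) - ‖b (f 0)‖ := by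
      field_simp
    have h5 : ‖b (f 0)‖ * Real.exp ((L + 1) * t) ≤ ‖b (f 0)‖ * Real.exp ((L + 1) * T) := by
      gcongr
      exact ht.2
    linarith [hlip t ht.1]
  refine ⟨hbd, fun s hs t ht => ?_⟩
  have h6 := (convex_Icc (0 : ℝ) T).norm_image_sub_le_of_norm_hasDerivWithin_le
    (fun r hr => (hode r hr.1).mono Icc_subset_Ici_self) hbd hs
    (⟨hs.1.trans ht.1, ht.2⟩ : t ∈ Icc 0 T)
  rwa [Real.norm_of_nonneg (sub_nonneg.2 ht.1)] at h6

/-- A priori bounds for Carathéodory solutions with a velocity of linear growth. -/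
lemma norm_le_of_eq_add_integral {W : Type*} [NormedAddCommGroup W] [NormedSpace ℝ W]
    [CompleteSpace W] {y g : ℝ → W} {k : ℝ → ℝ} {T : ℝ} (hT : 0 ≤ T)
    (hg : IntervalIntegrable g volume 0 T) (hy : ∀ t ∈ Icc 0 T, y t = y 0 + ∫ r in (0 : ℝ)..t, g r)
    (hk : IntervalIntegrable k volume 0 T) (hk0 : ∀ t ∈ Icc 0 T, 0 ≤ k t)
    (hgk : ∀ t ∈ Icc 0 T, ‖g t‖ ≤ k t * (1 + ‖y t‖)) :
    (∀ t ∈ Icc 0 T, ‖y t‖ ≤ (1 + ‖y 0‖) * Real.exp (∫ r in (0 : ℝ)..T, k r)) ∧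
    ∀ s ∈ Icc 0 T, ∀ t ∈ Icc s T,
      ‖y t - y s‖ ≤ (∫ r in s..t, k r) * ((1 + ‖y 0‖) * Real.exp (∫ r in (0 : ℝ)..T, k r)) := by
  have hsub : ∀ s ∈ Icc 0 T, ∀ t ∈ Icc s T, uIcc s t ⊆ uIcc 0 T := fun s hs t ht => by
    rw [uIcc_of_le ht.1, uIcc_of_le hT]
    exact Icc_subset_Icc hs.1 ht.2
  have hT0 : (0 : ℝ) ∈ Icc 0 T := ⟨le_rfl, hT⟩
  have hyc : ContinuousOn y (Icc 0 T) := by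
    have := intervalIntegral.continuousOn_primitive_interval' hg left_mem_uIcc
    rw [uIcc_of_le hT] at this
    exact (continuousOn_const.add this).congr hy
  have hvc : ContinuousOn (fun t => 1 + ‖y t‖) (Icc 0 T) := continuousOn_const.add hyc.norm
  have hkv : IntervalIntegrable (fun r => k r * (1 + ‖y r‖)) volume 0 T :=
    hk.mul_continuousOn (by rwa [uIcc_of_le hT])
  have hinc : ∀ s ∈ Icc 0 T, ∀ t ∈ Icc s T,
      ‖y t - y s‖ ≤ ∫ r in s..t, k r * (1 + ‖y r‖) := fun s hs t ht => by
    have ht' : t ∈ Icc 0 T := ⟨hs.1.trans ht.1, ht.2⟩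
    rw [hy t ht', hy s hs, add_sub_add_left_eq_sub, intervalIntegral.integral_interval_sub_left
      (hg.mono_set (hsub 0 hT0 t ht')) (hg.mono_set (hsub 0 hT0 s hs))]
    refine intervalIntegral.norm_integral_le_of_norm_le ht.1 ?_ (hkv.mono_set (hsub s hs t ht))
    exact Eventually.of_forall fun r hr => hgk r ⟨hs.1.trans hr.1.le, hr.2.trans ht.2⟩
  have hbd : ∀ t ∈ Icc 0 T, 1 + ‖y t‖ ≤ (1 + ‖y 0‖) * Real.exp (∫ r in (0 : ℝ)..T, k r) := by
    intro t ht
    -- Adding `1` to the norm makes the linear growth bound homogeneous.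
    have h1 := le_mul_exp_of_le_add_integral (u := fun t => 1 + ‖y t‖) (c := 1 + ‖y 0‖) ht.1
      (hvc.mono (Icc_subset_Icc_right ht.2)) (hk.mono_set (hsub 0 hT0 t ht))
      (fun r hr => hk0 r ⟨hr.1, hr.2.trans ht.2⟩) (fun r hr => by
        have h2 := hinc 0 hT0 r ⟨hr.1, hr.2.trans ht.2⟩
        have h3 : ‖y r‖ ≤ ‖y r - y 0‖ + ‖y 0‖ := by simpa using norm_add_le (y r - y 0) (y 0)
        linarith)
    refine h1.trans ?_
    gcongr
    have h4 := intervalIntegral.integral_add_adjacent_intervals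
      (hk.mono_set (hsub 0 hT0 t ht)) (hk.mono_set (hsub t ht T ⟨ht.2, le_rfl⟩))
    have h5 : 0 ≤ ∫ r in t..T, k r :=
      intervalIntegral.integral_nonneg ht.2 fun u hu => hk0 u ⟨ht.1.trans hu.1, hu.2⟩
    linarith
  refine ⟨fun t ht => by linarith [hbd t ht], fun s hs t ht => (hinc s hs t ht).trans ?_⟩
  rw [← intervalIntegral.integral_mul_const]
  refine intervalIntegral.integral_mono_on ht.1 (hkv.mono_set (hsub s hs t ht))
    ((hk.mono_set (hsub s hs t ht)).mul_const _) fun r hr => ?_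
  have hr' : r ∈ Icc 0 T := ⟨hs.1.trans hr.1, hr.2.trans ht.2⟩
  exact mul_le_mul_of_nonneg_left (hbd r hr') (hk0 r hr')

/-- If almost every path has the prescribed right derivative at almost every time, then at almost
every time almost every path has it. -/
lemma ae_ae_tendsto_slope {Ω W : Type*} [MeasurableSpace Ω] {Q : Measure Ω} [SFinite Q]
    [NormedAddCommGroup W] [NormedSpace ℝ W] [MeasurableSpace W] [BorelSpace W]
    [SecondCountableTopology W] {Y : ℝ → Ω → W} {G : ℝ × W → W} {T : ℝ}
    (hG : Measurable G) (hY : ∀ t, 0 ≤ t → Measurable (Y t))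
    (hc : ∀ᵐ ω ∂Q, ContinuousOn (fun t => Y t ω) (Ici 0)) {h : ℕ → ℝ} (hpos : ∀ n, 0 < h n)
    (hd : ∀ᵐ ω ∂Q, ∀ᵐ s, s ∈ Ioo 0 T →
      Tendsto (fun n => (h n)⁻¹ • (Y (s + h n) ω - Y s ω)) atTop (𝓝 (G (s, Y s ω)))) :
    ∀ᵐ s, s ∈ Ioo 0 T → ∀ᵐ ω ∂Q,
      Tendsto (fun n => (h n)⁻¹ • (Y (s + h n) ω - Y s ω)) atTop (𝓝 (G (s, Y s ω))) := by
  classical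
  -- The set of continuous paths need not be measurable, so it is replaced by a measurable subset of
  -- full measure. Off `S` the paths are set to zero, which makes `Z` continuous in time and hence
  -- jointly measurable.
  set S : Set Ω := (toMeasurable Q {ω | ContinuousOn (fun t => Y t ω) (Ici 0)}ᶜ)ᶜ with hS
  have hSm : MeasurableSet S := (measurableSet_toMeasurable _ _).compl
  have hSae : ∀ᵐ ω ∂Q, ω ∈ S := by
    rw [ae_iff]
    simp only [hS, mem_compl_iff, not_not]
    change Q (toMeasurable Q _) = 0
    rw [measure_toMeasurable]
    exact hc
  have hSc : ∀ ω ∈ S, ContinuousOn (fun t => Y t ω) (Ici 0) := fun ω hω => by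
    by_contra hn
    exact hω (subset_toMeasurable _ _ hn)
  let Z : ℝ → Ω → W := fun t ω => if ω ∈ S then Y (max t 0) ω else 0
  have hZm : Measurable (Function.uncurry Z) := by
    refine measurable_uncurry_of_continuous_of_measurable (fun ω => ?_) fun t => ?_
    · by_cases hω : ω ∈ S
      · simp only [Z, hω, if_true]
        exact (hSc ω hω).comp_continuous (continuous_id.max continuous_const)
          fun t => mem_Ici.2 (le_max_right _ _)
      · simp only [Z, hω, if_false]
        exact continuous_const
    · exact Measurable.ite hSm (hY _ (le_max_right _ _)) measurable_const
  have hZY : ∀ ω ∈ S, ∀ t, 0 ≤ t → Z t ω = Y t ω := fun ω hω t ht => by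
    simp [Z, hω, ht]
  have hconv : ∀ s ∈ Ioo 0 T, ∀ ω ∈ S,
      (Tendsto (fun n => (h n)⁻¹ • (Z (s + h n) ω - Z s ω) - G (s, Z s ω)) atTop (𝓝 0) ↔
      Tendsto (fun n => (h n)⁻¹ • (Y (s + h n) ω - Y s ω)) atTop (𝓝 (G (s, Y s ω)))) := by
    intro s hs ω hω
    rw [hZY ω hω s hs.1.le, tendsto_sub_nhds_zero_iff]
    simp_rw [fun n => hZY ω hω (s + h n) (add_nonneg hs.1.le (hpos n).le)]
  have hZs : Measurable fun q : ℝ × Ω => Z q.1 q.2 := hZm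
  have hZn : ∀ n, Measurable fun q : ℝ × Ω => Z (q.1 + h n) q.2 := fun n =>
    hZm.comp ((measurable_fst.add_const (h n)).prodMk measurable_snd)
  -- Subtracting the prospective limit turns it into the constant `0`, so that the set of
  -- convergence is measurable and Fubini applies.
  have hset : MeasurableSet {q : ℝ × Ω | q.1 ∈ Ioo 0 T → Tendsto (fun n =>
      (h n)⁻¹ • (Z (q.1 + h n) q.2 - Z q.1 q.2) - G (q.1, Z q.1 q.2)) atTop (𝓝 0)} := by
    have h1 : MeasurableSet {q : ℝ × Ω | Tendsto (fun n =>
        (h n)⁻¹ • (Z (q.1 + h n) q.2 - Z q.1 q.2) - G (q.1, Z q.1 q.2)) atTop (𝓝 0)} :=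
      measurableSet_tendsto _ fun n =>
        (((hZn n).sub hZs).const_smul _).sub (hG.comp (measurable_fst.prodMk hZs))
    have h2 : MeasurableSet {q : ℝ × Ω | q.1 ∈ Ioo 0 T} := measurable_fst measurableSet_Ioo
    exact h2.imp h1
  have hiff := Measure.ae_ae_comm (μ := (volume : Measure ℝ)) (ν := Q)
    (p := fun s ω => s ∈ Ioo 0 T → Tendsto (fun n =>
      (h n)⁻¹ • (Z (s + h n) ω - Z s ω) - G (s, Z s ω)) atTop (𝓝 0)) hset
  have h3 := hiff.2 (by
    filter_upwards [hSae, hd] with ω hω hdω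
    filter_upwards [hdω] with s hs hsI
    exact (hconv s hsI ω hω).2 (hs hsI))
  filter_upwards [h3] with s hs hsI
  filter_upwards [hs, hSae] with ω h4 h5
  exact (hconv s hsI ω h5).1 (h4 hsI)

end Curves

/-! ### The coordinate projections. -/

section Resolved

variable {m N : ℕ} (h : m < N)

/-- The projection to the resolved variables as a continuous linear map. -/
noncomputable def resolvedL : E N →L[ℝ] E m :=
  LinearMap.toContinuousLinearMap
    { toFun := resolved h
      map_add' := fun x y => by ext i; simp [resolved]
      map_smul' := fun c x => by ext i; simp [resolved] }

lemma resolvedL_apply (x : E N) : resolvedL h x = resolved h x := rfl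

lemma continuous_resolved : Continuous (resolved h) := (resolvedL h).continuous

lemma continuous_unresolved : Continuous (unresolved h) :=
  (PiLp.continuous_toLp 2 _).comp (continuous_pi fun j => by fun_prop)

lemma measurable_resolved : Measurable (resolved h) := (continuous_resolved h).measurable

lemma measurableSet_phaseSpace {Γr : Set (E m)} {Γu : Set (E (N - m))} (hΓr : MeasurableSet Γr)
    (hΓu : MeasurableSet Γu) : MeasurableSet (phaseSpace h Γr Γu) :=
  (measurable_resolved h hΓr).inter ((continuous_unresolved h).measurable hΓu)

end Resolved

/-! ### The projected drift and the law of the surrogate. -/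

section Application

variable {m N : ℕ} {h : m < N} {Γ : Set (E N)} {Γr : Set (E m)}

lemma aestronglyMeasurable_of_lipschitzOnWith {W : Type*} [NormedAddCommGroup W]
    [SecondCountableTopology W] {L : ℝ≥0} {f : E N → W} (hf : LipschitzOnWith L f Γ)
    (hΓ : MeasurableSet Γ) {ξ : Measure (E N)} (hξ : ξ Γᶜ = 0) : AEStronglyMeasurable f ξ := by
  have h1 : ξ.restrict Γ = ξ := Measure.restrict_eq_self_of_ae_mem (mem_ae_iff.2 hξ)
  rw [← h1]
  exact hf.continuousOn.aestronglyMeasurable hΓ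

lemma lipschitzOnWith_resolved_comp (h : m < N) {L : ℝ≥0} {b : E N → E N}
    (hb : LipschitzOnWith L b Γ) :
    LipschitzOnWith (‖resolvedL h‖₊ * L) (fun x => resolved h (b x)) Γ :=
  (resolvedL h).lipschitz.comp_lipschitzOnWith hb

section FullDynamics

variable {Ω : Type*} [MeasurableSpace Ω] {P : Measure Ω}
  {b : E N → E N} {L : ℝ≥0} {μ₀ : Measure (E N)} {X : ℝ → Ω → E N}

lemma IsFullSolution.map_compl_eq_zero (hX : IsFullSolution P Γ b μ₀ X) (hΓ : MeasurableSet Γ)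
    {t : ℝ} (ht : 0 ≤ t) : (P.map (X t)) Γᶜ = 0 := by
  rw [Measure.map_apply (hX.measurable t ht) hΓ.compl]
  rw [measure_eq_zero_iff_ae_notMem]
  filter_upwards [hX.mem] with ω hω hn using hn (hω t ht)

variable [IsProbabilityMeasure P]

/-- Square-integrable bounds for the full dynamics on bounded time intervals. -/
lemma IsFullSolution.exists_bound (hX : IsFullSolution P Γ b μ₀ X)
    (hb : LipschitzOnWith L b Γ) (hmom : MemLp id 2 μ₀) {T : ℝ} (hT : 0 ≤ T) :
    ∃ R : Ω → ℝ, MemLp R 2 P ∧ (∀ ω, 0 ≤ R ω) ∧ ∀ᵐ ω ∂P, ∀ s ∈ Icc 0 T, ‖X s ω‖ ≤ R ω ∧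
      ‖b (X s ω)‖ ≤ R ω ∧ ∀ t ∈ Icc s T, ‖X t ω - X s ω‖ ≤ (t - s) * R ω := by
  -- Some point `z` of `Γ` is needed to turn the Lipschitz bound into linear growth, as `0` may lie
  -- outside `Γ`.
  obtain ⟨ω₀, hω₀⟩ := hX.mem.exists
  set z := X 0 ω₀
  have hz : z ∈ Γ := hω₀ 0 le_rfl
  set c := Real.exp ((L + 1) * T) with hc
  have hX0 : MemLp (X 0) 2 P := by
    rw [← hX.initial] at hmom
    exact hmom.comp_of_map (hX.measurable 0 le_rfl).aemeasurable
  -- The factor `T + 1` serves two bounds: `T` times the speed for the position, and once the speed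
  -- for the field and the increments.
  refine ⟨fun ω => ‖X 0 ω‖ + (T + 1) * ((‖b z‖ + L * (‖X 0 ω‖ + ‖z‖)) * c), ?_, fun ω => ?_, ?_⟩
  · have m1 : MemLp (fun ω => ‖X 0 ω‖ + ‖z‖) 2 P := hX0.norm.add (memLp_const ‖z‖)
    have m2 : MemLp (fun ω => ‖b z‖ + L * (‖X 0 ω‖ + ‖z‖)) 2 P :=
      (memLp_const ‖b z‖).add (m1.const_mul (L : ℝ))
    have m3 : MemLp (fun ω => (T + 1) * ((‖b z‖ + L * (‖X 0 ω‖ + ‖z‖)) * c)) 2 P :=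
      (m2.mul_const c).const_mul (T + 1)
    exact hX0.norm.add m3
  · positivity
  · filter_upwards [hX.mem, hX.ode] with ω hmem hode
    obtain ⟨h1, h2⟩ := norm_le_of_hasDerivWithinAt_lipschitz (T := T) hb
      (f := fun t => X t ω) hmem hode
    have h3 : ‖b (X 0 ω)‖ ≤ ‖b z‖ + L * (‖X 0 ω‖ + ‖z‖) := by
      have e1 := hb.norm_sub_le (hmem 0 le_rfl) hz
      have e2 : ‖b (X 0 ω)‖ ≤ ‖b (X 0 ω) - b z‖ + ‖b z‖ := by
        simpa using norm_add_le (b (X 0 ω) - b z) (b z)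
      have e3 := mul_le_mul_of_nonneg_left (norm_sub_le (X 0 ω) z) L.coe_nonneg
      linarith
    have h4 : ‖b (X 0 ω)‖ * c ≤ (‖b z‖ + L * (‖X 0 ω‖ + ‖z‖)) * c := by gcongr
    set B := (‖b z‖ + L * (‖X 0 ω‖ + ‖z‖)) * c with hB
    have hB0 : 0 ≤ B := by positivity
    have h0 := norm_nonneg (X 0 ω)
    intro s hs
    refine ⟨?_, ?_, fun t ht => ?_⟩
    · have e1 := h2 0 ⟨le_rfl, hT⟩ s hs
      have e2 : ‖X s ω‖ ≤ ‖X s ω - X 0 ω‖ + ‖X 0 ω‖ := by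
        simpa using norm_add_le (X s ω - X 0 ω) (X 0 ω)
      have e3 : ‖b (X 0 ω)‖ * c * (s - 0) ≤ B * T :=
        mul_le_mul h4 (by linarith [hs.2]) (by linarith [hs.1]) hB0
      linarith
    · have e1 := h1 s hs
      nlinarith [mul_nonneg hT hB0]
    · refine (h2 s hs t ht).trans ?_
      rw [mul_comm]
      have : 0 ≤ t - s := sub_nonneg.2 ht.1
      gcongr
      nlinarith [mul_nonneg hT hB0]

lemma IsFullSolution.memLp_field (hX : IsFullSolution P Γ b μ₀ X) (hΓ : MeasurableSet Γ)
    (hb : LipschitzOnWith L b Γ) (hmom : MemLp id 2 μ₀) {t : ℝ} (ht : 0 ≤ t) :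
    MemLp b 2 (P.map (X t)) := by
  have hbm := aestronglyMeasurable_of_lipschitzOnWith hb hΓ (hX.map_compl_eq_zero hΓ ht)
  rw [memLp_map_measure_iff hbm (hX.measurable t ht).aemeasurable]
  obtain ⟨R, hR, -, hbd⟩ := hX.exists_bound hb hmom ht
  exact hR.mono' (hbm.comp_measurable (hX.measurable t ht))
    (hbd.mono fun ω hω => (hω t ⟨ht, le_rfl⟩).2.1)

end FullDynamics

variable {κ : Kernel (ℝ × E m) (E N)} {μ : ℝ → Measure (E N)} {K : ℝ → ℝ≥0}

/-- Integrability is required at `y` only and is carried to `z`; thus one good value of the resolved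
variables serves for all. -/
lemma projected_lipschitz {W : Type*} [NormedAddCommGroup W] [NormedSpace ℝ W]
    [SecondCountableTopology W] {L : ℝ≥0} {f : E N → W} (hf : LipschitzOnWith L f Γ)
    (hΓ : MeasurableSet Γ) {t : ℝ} {y z : E m} (hy : κ (t, y) Γᶜ = 0) (hz : κ (t, z) Γᶜ = 0)
    (hW : wasserstein1 (κ (t, y)) (κ (t, z)) ≤ K t * edist y z)
    (hi : Integrable f (κ (t, y))) :
    Integrable f (κ (t, z)) ∧ ‖projected κ f t y - projected κ f t z‖ ≤ L * K t * ‖y - z‖ := by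
  have hW' : wasserstein1 (κ (t, y)) (κ (t, z)) ≤ ((K t * nndist y z : ℝ≥0) : ℝ≥0∞) := by
    rw [ENNReal.coe_mul, ← edist_nndist]
    exact hW
  obtain ⟨h1, h2⟩ := integral_lipschitz_of_wasserstein1_le hΓ hf hy hz hW' hi
  refine ⟨h1, h2.trans (le_of_eq ?_)⟩
  rw [NNReal.coe_mul, coe_nndist, dist_eq_norm, mul_assoc]

/-- A jointly measurable version of the projected field. -/
lemma IsCondFamily.exists_measurable_projected (hκ : IsCondFamily h Γr Γ μ κ)
    (hΓ : MeasurableSet Γ) {n : ℕ} {f : E N → E n} (hf : ContinuousOn f Γ) :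
    ∃ G : ℝ × E m → E n, Measurable G ∧
      ∀ t, 0 ≤ t → ∀ y ∈ Γr, G (t, y) = projected κ f t y := by
  classical
  -- `f` is controlled on `Γ` only; cutting it off there gives a measurable integrand without
  -- changing the integrals, since the relevant conditional measures live on `Γ`.
  refine ⟨fun q => ∫ x, Γ.indicator f x ∂κ q, ?_, fun t ht y hy => ?_⟩
  · have hm : Measurable (Γ.indicator f) := by
      rw [← piecewise_eq_indicator]
      exact hf.measurable_piecewise continuousOn_const hΓ
    exact (hm.stronglyMeasurable.integral_kernel (κ := κ)).measurable
  · refine integral_congr_ae ?_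
    have : ∀ᵐ x ∂κ (t, y), x ∈ Γ := mem_ae_iff.2 (hκ.support t ht y hy)
    filter_upwards [this] with x hx
    exact indicator_of_mem hx f

variable [IsMarkovKernel κ]

/-- A Lipschitz function is integrable with respect to every conditional measure. -/
lemma IsCondFamily.integrable (hκ : IsCondFamily h Γr Γ μ κ)
    (hΓ : MeasurableSet Γ) {W : Type*} [NormedAddCommGroup W] [NormedSpace ℝ W]
    [SecondCountableTopology W] {L : ℝ≥0} {f : E N → W} (hf : LipschitzOnWith L f Γ) {t : ℝ}
    (ht : 0 ≤ t) [IsProbabilityMeasure (μ t)] (hμ : ∀ᵐ x ∂(μ t), resolved h x ∈ Γr)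
    (hΓr : MeasurableSet Γr)
    (hW : ∀ y ∈ Γr, ∀ z ∈ Γr, wasserstein1 (κ (t, y)) (κ (t, z)) ≤ K t * edist y z)
    (hi : Integrable f (μ t)) {y : E m} (hy : y ∈ Γr) : Integrable f (κ (t, y)) := by
  have : IsProbabilityMeasure ((μ t).map (resolved h)) :=
    Measure.isProbabilityMeasure_map (measurable_resolved h).aemeasurable
  have h1 := ae_integrable_of_disintegration (measurable_resolved h) (hκ.disintegrate t ht) hi
  have h2 : ∀ᵐ y ∂((μ t).map (resolved h)), y ∈ Γr :=
    (ae_map_iff (measurable_resolved h).aemeasurable hΓr).2 hμ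
  -- The disintegration gives integrability for almost every value only; the finite Wasserstein
  -- distance spreads it from `y₀` to all of `Γr`.
  obtain ⟨y₀, h3, h4⟩ := (h1.and h2).exists
  exact (projected_lipschitz (K := K) hf hΓ (hκ.support t ht y₀ h4) (hκ.support t ht y hy)
    (hW y₀ h4 y hy) h3).1

variable {Ω : Type*} [MeasurableSpace Ω] {P : Measure Ω} [IsProbabilityMeasure P]
  {b : E N → E N} {L : ℝ≥0} {μ₀ : Measure (E N)} {X : ℝ → Ω → E N} {Γu : Set (E (N - m))}

/-- The projected drift grows at most linearly, with a locally integrable rate. -/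
lemma norm_projected_le (hΓr : MeasurableSet Γr) (hΓu : MeasurableSet Γu)
    (hb : LipschitzOnWith L b (phaseSpace h Γr Γu)) (hmom : MemLp id 2 μ₀)
    (hX : IsFullSolution P (phaseSpace h Γr Γu) b μ₀ X)
    (hκ : IsCondFamily h Γr (phaseSpace h Γr Γu) (fun t => P.map (X t)) κ)
    (hW : ∀ t, 0 ≤ t → ∀ y ∈ Γr, ∀ z ∈ Γr,
      wasserstein1 (κ (t, y)) (κ (t, z)) ≤ K t * edist y z) {T : ℝ} (hT : 0 ≤ T) :
    ∃ C : ℝ, 1 ≤ C ∧ ∀ t ∈ Icc 0 T, ∀ y ∈ Γr,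
      ‖projected κ (fun x => resolved h (b x)) t y‖ ≤ C * (1 + K t) * (1 + ‖y‖) := by
  have hΓ := measurableSet_phaseSpace h hΓr hΓu
  obtain ⟨R, hR, hR0, hbd⟩ := hX.exists_bound hb hmom hT
  set ρ := ‖resolvedL h‖ with hρ
  set r := ∫ ω, R ω ∂P with hr
  have hr0 : 0 ≤ r := integral_nonneg hR0
  have hρ0 : 0 ≤ ρ := norm_nonneg _
  have hRi : Integrable R P := hR.integrable (by norm_num)
  have hf := lipschitzOnWith_resolved_comp h hb
  set L' : ℝ≥0 := ‖resolvedL h‖₊ * L with hL'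
  set f : E N → E m := fun x => resolved h (b x) with hfdef
  -- The summand `1` ensures `1 ≤ C`, so that the rate `C * (1 + K t)` also dominates elapsed time.
  refine ⟨1 + ρ * r + L' + L' * (ρ * r), ?_, fun t ht y hy => ?_⟩
  · have : (0 : ℝ) ≤ L' := L'.coe_nonneg
    have : 0 ≤ ρ * r := by positivity
    have : 0 ≤ L' * (ρ * r) := by positivity
    linarith
  have hXm := hX.measurable t ht.1
  have : IsProbabilityMeasure (P.map (X t)) := Measure.isProbabilityMeasure_map hXm.aemeasurable
  have hfL : MemLp f 2 (P.map (X t)) :=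
    (resolvedL h).comp_memLp' (hX.memLp_field hΓ hb hmom ht.1)
  have hfi : Integrable f (P.map (X t)) := hfL.integrable (by norm_num)
  have hd := hκ.disintegrate t ht.1
  have hpi := (integral_integral_of_disintegration (measurable_resolved h) hd hfi).1.norm
  have hple := integral_norm_integral_le_of_disintegration (measurable_resolved h) hd hfi
  rw [integral_map (measurable_resolved h).aemeasurable hpi.1] at hple
  have hpi' : Integrable (fun x => ‖projected κ f t (resolved h x)‖) (P.map (X t)) :=
    hpi.comp_measurable (measurable_resolved h)
  have hpi'' : Integrable (fun ω => ‖projected κ f t (resolved h (X t ω))‖) P :=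
    hpi'.comp_measurable hXm
  change ∫ x, ‖projected κ f t (resolved h x)‖ ∂(P.map (X t)) ≤ _ at hple
  rw [integral_map hXm.aemeasurable hpi'.1, integral_map hXm.aemeasurable hfi.norm.1] at hple
  have hfr : ∫ ω, ‖f (X t ω)‖ ∂P ≤ ρ * r := by
    rw [hr, ← integral_const_mul]
    refine integral_mono_of_nonneg (Eventually.of_forall fun _ => norm_nonneg _)
      (hRi.const_mul _) ?_
    filter_upwards [hbd] with ω hω
    exact ((resolvedL h).le_opNorm _).trans (by gcongr; exact (hω t ht).2.1)
  have hmemX : ∀ᵐ ω ∂P, resolved h (X t ω) ∈ Γr := hX.mem.mono fun ω hω => (hω t ht.1).1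
  -- The drift at `y` is compared with its value at the random point `resolved h (X t ω)` and then
  -- averaged over `ω`, because only the mean size of the drift is known a priori.
  have hpt : ∀ᵐ ω ∂P, ‖projected κ f t y‖ ≤
      ‖projected κ f t (resolved h (X t ω))‖ + L' * K t * (‖y‖ + ρ * R ω) := by
    filter_upwards [hmemX, hbd] with ω h1 h2
    have hi : Integrable f (κ (t, y)) :=
      hκ.integrable hΓ hf ht.1 (ae_map_iff hXm.aemeasurable
        (measurable_resolved h hΓr) |>.2 hmemX) hΓr (hW t ht.1) hfi hy
    have e1 := (projected_lipschitz (K := K) hf hΓ (hκ.support t ht.1 y hy)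
      (hκ.support t ht.1 _ h1) (hW t ht.1 y hy _ h1) hi).2
    have e2 : ‖projected κ f t y‖ ≤ ‖projected κ f t y - projected κ f t (resolved h (X t ω))‖
        + ‖projected κ f t (resolved h (X t ω))‖ := by
      simpa using norm_add_le (projected κ f t y - projected κ f t (resolved h (X t ω)))
        (projected κ f t (resolved h (X t ω)))
    have e3 : ‖y - resolved h (X t ω)‖ ≤ ‖y‖ + ρ * R ω := by
      refine (norm_sub_le _ _).trans ?_
      gcongr
      exact ((resolvedL h).le_opNorm _).trans (by gcongr; exact (h2 t ht).1)
    have e4 : (L' : ℝ) * K t * ‖y - resolved h (X t ω)‖ ≤ L' * K t * (‖y‖ + ρ * R ω) := by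
      gcongr
    linarith
  have hi2 : Integrable (fun ω => (L' : ℝ) * K t * (‖y‖ + ρ * R ω)) P :=
    ((integrable_const _).add (hRi.const_mul _)).const_mul _
  have hint : ‖projected κ f t y‖ ≤
      ∫ ω, (‖projected κ f t (resolved h (X t ω))‖ + L' * K t * (‖y‖ + ρ * R ω)) ∂P := by
    have := integral_mono_ae (integrable_const _) (hpi''.add hi2) hpt
    simpa using this
  have hsplit : ∫ ω, (‖projected κ f t (resolved h (X t ω))‖ + L' * K t * (‖y‖ + ρ * R ω)) ∂P
      = (∫ ω, ‖projected κ f t (resolved h (X t ω))‖ ∂P) + L' * K t * (‖y‖ + ρ * r) := by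
    have e := integral_add hpi'' hi2
    rw [integral_const_mul, integral_add (integrable_const _) (hRi.const_mul _),
      integral_const_mul] at e
    simpa using e
  rw [hsplit] at hint
  have hple' : ∫ ω, ‖projected κ f t (resolved h (X t ω))‖ ∂P ≤ ρ * r := hple.trans hfr
  refine (hint.trans (add_le_add_left hple' _)).trans ?_
  have hl : (0 : ℝ) ≤ L' := L'.coe_nonneg
  have hKt : (0 : ℝ) ≤ K t := (K t).coe_nonneg
  have hy0 := norm_nonneg y
  set q := ρ * r
  have hq : 0 ≤ q := by positivity
  set l := (L' : ℝ)
  set a := (K t : ℝ)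
  set u := ‖y‖
  have : (1 + q + l + l * q) * (1 + a) * (1 + u) - (q + l * a * (u + q))
      = (1 + q + l + l * q) + (1 + q + l + l * q) * u + (1 + q + l + l * q) * a
        + (1 + q + l * q) * (a * u) - q - l * a * q := by ring
  have p1 : 0 ≤ (1 + q + l + l * q) * u := by positivity
  have p2 : 0 ≤ (1 + q + l * q) * (a * u) := by positivity
  have p3 : 0 ≤ (1 + q + l) * a := by positivity
  have p4 : 0 ≤ l * q := by positivity
  linarith

/-- Every surrogate trajectory has the law of the resolved variables. -/
theorem map_surrogate_eq (hΓr : MeasurableSet Γr) (hΓu : MeasurableSet Γu)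
    (hb : LipschitzOnWith L b (phaseSpace h Γr Γu)) (hmom : MemLp id 2 μ₀)
    (hX : IsFullSolution P (phaseSpace h Γr Γu) b μ₀ X)
    (hκ : IsCondFamily h Γr (phaseSpace h Γr Γu) (fun t => P.map (X t)) κ)
    (hK : LocallyIntegrableOn (fun t => (K t : ℝ)) (Ici 0) volume)
    (hW : ∀ t, 0 ≤ t → ∀ y ∈ Γr, ∀ z ∈ Γr,
      wasserstein1 (κ (t, y)) (κ (t, z)) ≤ K t * edist y z)
    {Ω' : Type*} [MeasurableSpace Ω'] {Q : Measure Ω'} [IsProbabilityMeasure Q]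
    {Y : ℝ → Ω' → E m} (hY : IsSurrogateSolution Q Γr
      (projected κ fun x => resolved h (b x)) (μ₀.map (resolved h)) Y) {T : ℝ} (hT : 0 ≤ T) :
    Q.map (Y T) = (P.map (X T)).map (resolved h) := by
  have hΓ := measurableSet_phaseSpace h hΓr hΓu
  obtain ⟨R, hR, hR0, hbd⟩ := hX.exists_bound hb hmom hT
  obtain ⟨C, hC1, hC⟩ := norm_projected_le hΓr hΓu hb hmom hX hκ hW hT
  have hf := lipschitzOnWith_resolved_comp h hb
  obtain ⟨G, hGm, hG⟩ := hκ.exists_measurable_projected hΓ hf.continuousOn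
  have hKi : IntervalIntegrable (fun t => (K t : ℝ)) volume 0 T :=
    (intervalIntegrable_iff_integrableOn_Icc_of_le hT).2
      (hK.integrableOn_compact_subset Icc_subset_Ici_self isCompact_Icc)
  -- This single rate governs both curves: it bounds the growth of the drift along `Y` and, being at
  -- least `1`, the increments of the resolved part of `X`.
  have hk : IntervalIntegrable (fun t => C * (1 + (K t : ℝ))) volume 0 T :=
    (intervalIntegrable_const.add hKi).const_mul C
  have hk1 : ∀ t, 1 ≤ C * (1 + (K t : ℝ)) := fun t => by
    nlinarith [(K t).coe_nonneg]
  have hT0 : (0 : ℝ) ∈ Icc 0 T := ⟨le_rfl, hT⟩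
  set ρ := ‖resolvedL h‖ with hρ
  have hρ0 : 0 ≤ ρ := norm_nonneg _
  set f : E N → E m := fun x => resolved h (b x) with hfdef
  have hmeasX : ∀ t, 0 ≤ t → Measurable fun ω => resolved h (X t ω) := fun t ht =>
    (measurable_resolved h).comp (hX.measurable t ht)
  have hprob : ∀ t, 0 ≤ t → IsProbabilityMeasure (P.map (X t)) := fun t ht =>
    Measure.isProbabilityMeasure_map (hX.measurable t ht).aemeasurable
  have hfL : ∀ t, 0 ≤ t → MemLp f 2 (P.map (X t)) := fun t ht =>
    (resolvedL h).comp_memLp' (hX.memLp_field hΓ hb hmom ht)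
  have hmemX : ∀ t, 0 ≤ t → ∀ᵐ ω ∂P, resolved h (X t ω) ∈ Γr := fun t ht =>
    hX.mem.mono fun ω hω => (hω t ht).1
  have hmemY : ∀ t, 0 ≤ t → ∀ᵐ ω ∂Q, Y t ω ∈ Γr := fun t ht => hY.mem.mono fun ω hω => hω t ht
  have hfint : ∀ t, 0 ≤ t → ∀ y ∈ Γr, Integrable f (κ (t, y)) := fun t ht y hy => by
    have := hprob t ht
    exact hκ.integrable hΓ hf ht (ae_map_iff (hX.measurable t ht).aemeasurable
        (measurable_resolved h hΓr) |>.2 (hmemX t ht)) hΓr (hW t ht)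
        ((hfL t ht).integrable (by norm_num)) hy
  have hY0 : MemLp (Y 0) 2 Q := by
    have h1 : MemLp id 2 (μ₀.map (resolved h)) :=
      (memLp_map_measure_iff aestronglyMeasurable_id
        (measurable_resolved h).aemeasurable).2 ((resolvedL h).comp_memLp' hmom)
    rw [← hY.initial] at h1
    exact h1.comp_of_map (hY.measurable 0 le_rfl).aemeasurable
  set e := Real.exp (∫ r in (0 : ℝ)..T, C * (1 + (K r : ℝ))) with he
  have hYb : ∀ᵐ ω ∂Q, (∀ t ∈ Icc 0 T, ‖Y t ω‖ ≤ (1 + ‖Y 0 ω‖) * e) ∧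
      ∀ s ∈ Icc 0 T, ∀ t ∈ Icc s T,
        ‖Y t ω - Y s ω‖ ≤ (∫ r in s..t, C * (1 + (K r : ℝ))) * ((1 + ‖Y 0 ω‖) * e) := by
    filter_upwards [hY.mem, hY.integrable, hY.ode] with ω h1 h2 h3
    exact norm_le_of_eq_add_integral hT (h2 T hT) (fun t ht => h3 t ht.1) hk
      (fun t _ => zero_le_one.trans (hk1 t)) fun t ht => hC t ht _ (h1 t ht.1)
  -- Lebesgue differentiation gives the velocity of each path at almost every time; the jointly
  -- measurable version `G` allows the two quantifiers to be exchanged.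
  have hYd : ∀ᵐ s, s ∈ Ioo 0 T → ∀ᵐ ω ∂Q,
      Tendsto (fun n : ℕ => (1 / ((n : ℝ) + 1))⁻¹ • (Y (s + 1 / ((n : ℝ) + 1)) ω - Y s ω))
        atTop (𝓝 (G (s, Y s ω))) := by
    refine ae_ae_tendsto_slope (h := fun n : ℕ => 1 / ((n : ℝ) + 1)) hGm hY.measurable ?_
      (fun n => by positivity) ?_
    · filter_upwards [hY.integrable, hY.ode] with ω h2 h3
      have hcI : ∀ S, 0 ≤ S → ContinuousOn (fun t => Y t ω) (Icc 0 S) := fun S hS => by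
        have := intervalIntegral.continuousOn_primitive_interval' (h2 S hS) left_mem_uIcc
        rw [uIcc_of_le hS] at this
        exact (continuousOn_const.add this).congr fun t ht => h3 t ht.1
      intro t ht
      have hc := hcI (t + 1) (by linarith [mem_Ici.1 ht]) t ⟨ht, by linarith⟩
      refine hc.mono_of_mem_nhdsWithin ?_
      rw [← Ici_inter_Iic]
      exact inter_mem self_mem_nhdsWithin (mem_nhdsWithin_of_mem_nhds (Iic_mem_nhds (by linarith)))
    · filter_upwards [hY.mem, hY.integrable, hY.ode] with ω h1 h2 h3
      filter_upwards [(h2 T hT).ae_hasDerivAt_integral] with s hs hsI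
      have hd := hs (by rw [uIcc_of_le hT]; exact Ioo_subset_Icc_self hsI) 0 (by simp)
      rw [hG s hsI.1.le _ (h1 s hsI.1.le)]
      have hd' : HasDerivWithinAt (fun t => Y t ω) (projected κ f s (Y s ω)) (Ici s) s :=
        (hd.const_add (Y 0 ω)).hasDerivWithinAt.congr
          (fun t ht => h3 t (hsI.1.le.trans ht)) (h3 s hsI.1.le)
      have hpos : ∀ n : ℕ, 0 < 1 / ((n : ℝ) + 1) := fun n => by positivity
      have hten := tendsto_inv_smul_sub_of_hasDerivWithinAt hd'
        tendsto_one_div_add_atTop_nhds_zero_nat hpos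
      exact hten
  have hR₂ : MemLp (fun ω => (1 + ‖Y 0 ω‖) * e) 2 Q := by
    have m0 : MemLp (fun ω => ‖Y 0 ω‖) 2 Q := hY0.norm
    have m1 : MemLp (fun ω => 1 + ‖Y 0 ω‖) 2 Q := (memLp_const (1 : ℝ)).add m0
    exact MemLp.mul_const m1 e
  have hxb : ∀ᵐ ω ∂P, ∀ t ∈ Icc 0 T, ‖resolved h (X t ω)‖ ≤ (1 + ρ) * R ω := by
    filter_upwards [hbd] with ω hω t ht
    have h1 := ((resolvedL h).le_opNorm (X t ω)).trans
      (mul_le_mul_of_nonneg_left (hω t ht).1 hρ0)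
    have h2 := hR0 ω
    rw [resolvedL_apply] at h1
    linarith
  have hxi : ∀ᵐ ω ∂P, ∀ s ∈ Icc 0 T, ∀ t ∈ Icc s T,
      ‖resolved h (X t ω) - resolved h (X s ω)‖
        ≤ (∫ r in s..t, C * (1 + (K r : ℝ))) * ((1 + ρ) * R ω) := by
    filter_upwards [hbd] with ω hω s hs t ht
    have h1 := ((resolvedL h).le_opNorm (X t ω - X s ω)).trans
      (mul_le_mul_of_nonneg_left ((hω s hs).2.2 t ht) hρ0)
    rw [map_sub, resolvedL_apply, resolvedL_apply] at h1
    refine h1.trans ?_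
    have hki : IntervalIntegrable (fun t => C * (1 + (K t : ℝ))) volume s t :=
      hk.mono_set (by
        rw [uIcc_of_le ht.1, uIcc_of_le hT]
        exact Icc_subset_Icc hs.1 ht.2)
    have h2 : t - s ≤ ∫ r in s..t, C * (1 + (K r : ℝ)) := by
      have := intervalIntegral.integral_mono_on ht.1 (intervalIntegrable_const (c := (1 : ℝ)))
        hki fun r _ => hk1 r
      simpa using this
    have h3 := hR0 ω
    have h4 : 0 ≤ t - s := sub_nonneg.2 ht.1
    calc ρ * ((t - s) * R ω) ≤ (t - s) * ((1 + ρ) * R ω) := by nlinarith [mul_nonneg h4 h3]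
      _ ≤ _ := by gcongr
  have hvm : ∀ s, 0 ≤ s → AEStronglyMeasurable (fun ω => f (X s ω)) P := fun s hs =>
    (hfL s hs).1.comp_measurable (hX.measurable s hs)
  have hFy : ∀ s, 0 ≤ s → AEStronglyMeasurable (fun ω => projected κ f s (Y s ω)) Q := by
    intro s hs
    refine AEStronglyMeasurable.congr (f := fun ω => G (s, Y s ω)) ?_ ?_
    · exact (hGm.comp (measurable_const.prodMk (hY.measurable s hs))).aestronglyMeasurable
    · filter_upwards [hmemY s hs] with ω hω
      exact hG s hs _ hω
  have hFx : ∀ s, 0 ≤ s → MemLp (fun ω => projected κ f s (resolved h (X s ω))) 2 P := by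
    intro s hs
    have := hprob s hs
    have h1 : MemLp (projected κ f s) 2 ((P.map (X s)).map (resolved h)) :=
      memLp_integral_of_disintegration (measurable_resolved h) (hκ.disintegrate s hs) (hfL s hs)
    rw [Measure.map_map (measurable_resolved h) (hX.measurable s hs)] at h1
    exact h1.comp_of_map (hmeasX s hs).aemeasurable
  have hdx : ∀ s, 0 ≤ s → ∀ᵐ ω ∂P,
      HasDerivWithinAt (fun t => resolved h (X t ω)) (f (X s ω)) (Ici s) s := fun s hs => by
    filter_upwards [hX.ode] with ω hω
    have h1 := (resolvedL h).hasFDerivAt.comp_hasDerivWithinAt s (hω s hs)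
    exact h1.mono (Ici_subset_Ici.2 hs)
  have hdy : ∀ᵐ s, s ∈ Ioo 0 T → ∀ᵐ ω ∂Q,
      Tendsto (fun n : ℕ => (1 / ((n : ℝ) + 1))⁻¹ • (Y (s + 1 / ((n : ℝ) + 1)) ω - Y s ω))
        atTop (𝓝 (projected κ f s (Y s ω))) := by
    filter_upwards [hYd] with s hs hsI
    filter_upwards [hs hsI, hmemY s hsI.1.le] with ω h1 h2
    rwa [hG s hsI.1.le _ h2] at h1
  have hlip : ∀ s, 0 ≤ s → ∀ᵐ p ∂P.prod Q,
      ‖projected κ f s (resolved h (X s p.1)) - projected κ f s (Y s p.2)‖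
        ≤ (‖resolvedL h‖₊ * L : ℝ≥0) * (K s : ℝ) * ‖resolved h (X s p.1) - Y s p.2‖ := by
    intro s hs
    have h1 := Measure.quasiMeasurePreserving_fst (μ := P) (ν := Q) |>.ae (hmemX s hs)
    have h2 := Measure.quasiMeasurePreserving_snd (μ := P) (ν := Q) |>.ae (hmemY s hs)
    filter_upwards [h1, h2] with p hp hq
    exact (projected_lipschitz (K := K) hf hΓ (hκ.support s hs _ hp)
      (hκ.support s hs _ hq) (hW s hs _ hp _ hq) (hfint s hs _ hp)).2
  have hcond : ∀ s, 0 ≤ s → ∀ ψ : E m → E m, Measurable ψ →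
      Integrable (fun ω => inner ℝ (ψ (resolved h (X s ω)))
        (f (X s ω) - projected κ f s (resolved h (X s ω)))) P →
      ∫ ω, inner ℝ (ψ (resolved h (X s ω)))
        (f (X s ω) - projected κ f s (resolved h (X s ω))) ∂P = 0 := by
    intro s hs ψ hψ hint
    have := hprob s hs
    have hXm := hX.measurable s hs
    have hfi := (hfL s hs).integrable (by norm_num)
    have hpm : AEStronglyMeasurable (projected κ f s) ((P.map (X s)).map (resolved h)) :=
      aestronglyMeasurable_integral_of_disintegration (measurable_resolved h)
        (hκ.disintegrate s hs) hfi.1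
    have hm : AEStronglyMeasurable (fun x => inner ℝ (ψ (resolved h x))
        (f x - projected κ f s (resolved h x))) (P.map (X s)) :=
      (hψ.comp (measurable_resolved h)).aestronglyMeasurable.inner
        (hfi.1.sub (hpm.comp_measurable (measurable_resolved h)))
    have hi := (integrable_map_measure hm hXm.aemeasurable).2 hint
    have h1 : ∫ x, inner ℝ (ψ (resolved h x)) (f x - projected κ f s (resolved h x))
        ∂(P.map (X s)) = 0 :=
      integral_inner_sub_eq_zero_of_disintegration (measurable_resolved h)
        (hκ.disintegrate s hs) hfi hψ.aestronglyMeasurable hi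
    rwa [integral_map hXm.aemeasurable hm] at h1
  have hinit : P.map (fun ω => resolved h (X 0 ω)) = Q.map (Y 0) := by
    rw [hY.initial, ← hX.initial, Measure.map_map (measurable_resolved h)
      (hX.measurable 0 le_rfl)]
    rfl
  have hkey := map_eq_of_conditional_velocity (P := P) (Q := Q)
    (x := fun t ω => resolved h (X t ω)) (v := fun t ω => f (X t ω)) (y := Y)
    (F := projected κ f) (R₁ := fun ω => (1 + ρ) * R ω)
    (R₂ := fun ω => (1 + ‖Y 0 ω‖) * e) (ℓ := fun t => (‖resolvedL h‖₊ * L : ℝ≥0) * (K t : ℝ))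
    hT hk (fun t _ => zero_le_one.trans (hk1 t)) (hKi.const_mul _) (fun t _ => by positivity)
    (fun t ht => hmeasX t ht.1) (fun t ht => hY.measurable t ht.1) (hR.const_mul _) hR₂
    hxb (hYb.mono fun ω hω => hω.1) hxi (hYb.mono fun ω hω => hω.2)
    (ae_of_all _ fun s hs => hvm s hs.1.le) (ae_of_all _ fun s hs => hFy s hs.1.le)
    (ae_of_all _ fun s hs => hFx s hs.1.le) (ae_of_all _ fun s hs => hdx s hs.1.le) hdy
    (ae_of_all _ fun s hs => hlip s hs.1.le) (ae_of_all _ fun s hs => hcond s hs.1.le) hinit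
  rw [← hkey, Measure.map_map (measurable_resolved h) (hX.measurable T hT)]
  rfl

end Application

end Surrogate

theorem proposition2 {m N : ℕ} (h : m < N)
    -- the phase space, a product of a resolved and an unresolved part
    (Γr : Set (E m)) (Γu : Set (E (N - m))) (hΓr : MeasurableSet Γr) (hΓu : MeasurableSet Γu)
    -- a globally Lipschitz vector field on it
    (b : E N → E N) (L : ℝ≥0) (hb : LipschitzOnWith L b (phaseSpace h Γr Γu))
    -- the initial law: absolutely continuous with finite second moment
    (μ₀ : Measure (E N)) [IsProbabilityMeasure μ₀] (hac : μ₀ ≪ volume) (hmom : MemLp id 2 μ₀)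
    -- the full dynamics
    {Ω : Type*} [MeasurableSpace Ω] (P : Measure Ω) [IsProbabilityMeasure P]
    (X : ℝ → Ω → E N) (hX : IsFullSolution P (phaseSpace h Γr Γu) b μ₀ X)
    -- the conditional measures, Lipschitz in the resolved variables for the Wasserstein distance
    (κ : Kernel (ℝ × E m) (E N)) [IsMarkovKernel κ]
    (hκ : IsCondFamily h Γr (phaseSpace h Γr Γu) (fun t => P.map (X t)) κ)
    (K : ℝ → ℝ≥0) (hK : LocallyIntegrableOn (fun t => (K t : ℝ)) (Ici 0) volume)
    (hW : ∀ t, 0 ≤ t → ∀ y ∈ Γr, ∀ z ∈ Γr,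
      wasserstein1 (κ (t, y)) (κ (t, z)) ≤ K t * edist y z) :
    -- every surrogate has the resolved marginal of the full dynamics at every time
    (∀ {Ω' : Type*} [MeasurableSpace Ω'] (Q : Measure Ω') [IsProbabilityMeasure Q]
      (Y : ℝ → Ω' → E m),
      IsSurrogateSolution Q Γr (projected κ fun x => resolved h (b x))
        (μ₀.map (resolved h)) Y →
      ∀ t, 0 ≤ t → Q.map (Y t) = (P.map (X t)).map (resolved h)) ∧
    -- the projected drift is the optimal projection, of the resolved drift and of the whole field
    (∀ t, 0 ≤ t →
      IsOptimalProjection (P.map (X t)) (resolved h) (fun x => resolved h (b x))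
        (projected κ (fun x => resolved h (b x)) t) ∧
      IsOptimalProjection (P.map (X t)) (resolved h) b (projected κ b t) ∧
      ∀ y ∈ Γr, projected κ (fun x => resolved h (b x)) t y = resolved h (projected κ b t y)) := by
  have hΓ := measurableSet_phaseSpace h hΓr hΓu
  refine ⟨fun Q _ Y hY t ht => map_surrogate_eq hΓr hΓu hb hmom hX hκ hK hW hY ht,
    fun t ht => ?_⟩
  have hXm := hX.measurable t ht
  have hprob : IsProbabilityMeasure (P.map (X t)) :=
    Measure.isProbabilityMeasure_map hXm.aemeasurable
  have hbL := hX.memLp_field hΓ hb hmom ht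
  have hd := hκ.disintegrate t ht
  refine ⟨isOptimalProjection_of_disintegration (measurable_resolved h) hd
    ((resolvedL h).comp_memLp' hbL),
    isOptimalProjection_of_disintegration (measurable_resolved h) hd hbL, fun y hy => ?_⟩
  have hmem : ∀ᵐ x ∂(P.map (X t)), resolved h x ∈ Γr :=
    (ae_map_iff hXm.aemeasurable (measurable_resolved h hΓr)).2
      (hX.mem.mono fun ω hω => (hω t ht).1)
  -- Integrability at every `y`, not just almost every one, makes the interchange of projection and
  -- integral valid pointwise on `Γr`.
  have hi : Integrable b (κ (t, y)) :=
    hκ.integrable hΓ hb ht hmem hΓr (hW t ht) (hbL.integrable (by norm_num)) hy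
  exact (resolvedL h).integral_comp_comm hi
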